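/- **Setting.** Let $s\ge 1$, let $Q\subset\mathbb R^d$, and for $t=1,\dots,s$ let $D_t=\{x^{(t)}_1,\dots,x^{(t)}_{n_t}\}\subset Q$ be design sets with $D_s\subseteq\dots\subseteq D_1$. Let $f_t:Q\to\mathbb R^{p_t}$ ($1\le t\le s$) and $f_{\rho_{t-1}}:Q\to\mathbb R^{q_{t-1}}$ ($2\le t\le s$) be regression functions, and let $r_t(\cdot\,;\theta_t)$ be correlation functions with fixed hyper-parameters $\theta_t$ such that the matrix $R_t=\big(r_t(x^{(t)}_i-x^{(t)}_j;\theta_t)\big)_{i,j}$ is positive definite for every $t$. Given coefficients $\beta_t\in\mathbb R^{p_t}$, $\beta_{\rho_{t-1}}\in\mathbb R^{q_{t-1}}$ and variances $\sigma_t^2>0$, the process $Z_1$ is Gaussian with mean $f_1^T\beta_1$ and covariance $\sigma_1^2 r_1(x-x';\theta_1)$, and for $t\ge2$ $$Z_t(x)=\rho_{t-1}(x)Z_{t-1}(x)+\delta_t(x),\qquad \rho_{t-1}(x)=f_{\rho_{t-1}}(x)^T\beta_{\rho_{t-1}},$$ where $\delta_t$ is a Gaussian process with mean $f_t^T\beta_t$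 and covariance $\sigma_t^2r_t(x-x';\theta_t)$, independent of $(Z_1,\dots,Z_{t-1})$. (Constant $\rho_{t-1}$ is the case $q_{t-1}=1$, $f_{\rho_{t-1}}=1$, where $\rho_{t-1}=\beta_{\rho_{t-1}}$.) The observations are $z_t\in\mathbb R^{n_t}$, the values of $Z_t$ on $D_t$; $z_{t-1}(D_t)$ is the subvector of $z_{t-1}$ belonging to the points of $D_t\subseteq D_{t-1}$. Let $F_t(D_t)$ and $F_{\rho_{t-1}}(D_t)$ be the matrices with rows $f_t(x^{(t)}_i)^T$ and $f_{\rho_{t-1}}(x^{(t)}_i)^T$, and put $H_1=F_1(D_1)$, $\lambda_1=\beta_1$, $k_1=p_1$, and for $t\ge 2$, with $\odot$ the entrywise product, $$H_t=\big[F_{\rho_{t-1}}(D_t)\odot (z_{t-1}(D_t)\mathbf 1_{q_{t-1}}^T)\quad F_t(D_t)\big],\qquad \lambda_t=(\beta_{\rho_{t-1}},\beta_t),\qquad k_t=p_t+q_{t-1},$$ so that $H_t=[z_{t-1}(D_t)\ \ F_t(D_t)]$ and $k_t=p_t+1$ when $\rho_{t-1}$ is constant. Whenever $H_t$ has linearly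 independent columns, put $$\hat\lambda_t=(H_t^TR_t^{-1}H_t)^{-1}H_t^TR_t^{-1}z_t,\qquad Q_t=(z_t-H_t\hat\lambda_t)^TR_t^{-1}(z_t-H_t\hat\lambda_t),\qquad \alpha_t=\frac{n_t-k_t}{2}.$$ The priors are the Jeffreys priors: $p(\lambda_t\mid\sigma_t^2)\propto1$, $p(\sigma_t^2)\propto1/\sigma_t^2$, independently over $t$. Posteriors are given by the Bayes formula (likelihood times prior, normalized, the normalizing constant being positive and finite). For $t\ge 2$, the posteriors of $\lambda_t,\sigma_t^2$ given $z_t,z_{t-1}$ use as likelihood the conditional density of $Z_t(D_t)$ at $z_t$ given $Z_{t-1}(D_{t-1})=z_{t-1}$ (they do not depend on the parameters of the other levels, which are held fixed); for $t=1$ the likelihood is the density of $Z_1(D_1)$ at $z_1$. $\mathcal{IG}(\alpha,Q)$ has density $\frac{Q^\alpha}{\Gamma(\alpha)}\frac{e^{-Q/x}}{x^{\alpha+1}}\mathbf 1_{x>0}$. **Statement.** 1. For each $t$ such that $H_t$ has linearly independent columns, and each $\sigma_t^2>0$, $$[\lambda_t\mid z_t,z_{t-1},\theta_t,\sigma_t^2]\sim\mathcal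 N\big(\hat\lambda_t,\ \sigma_t^2(H_t^TR_t^{-1}H_t)^{-1}\big)$$ (without $z_{t-1}$ if $t=1$). 2. If moreover $z_t$ is not in the column space of $H_t$ (which forces $n_t>k_t$ and $Q_t>0$), then $$[\sigma_t^2\mid z_t,z_{t-1},\theta_t]\sim\mathcal{IG}\big(\alpha_t,\tfrac{Q_t}{2}\big),$$ and the joint posterior of $(\lambda_t,\sigma_t^2)$ is this law of $\sigma_t^2$ combined with the Gaussian law of part 1 for $\lambda_t$ given $\sigma_t^2$. 3. (Decoupling.) If the conditions of parts 1 and 2 hold for all $t=1,\dots,s$, then the posterior of all the parameters $(\lambda_t,\sigma_t^2)_{t=1,\dots,s}$ given all the observations $z_1,\dots,z_s$ is the product over $t$ of the posteriors of part 2, and the $t$-th factor is the posterior, under the Jeffreys prior, of the one-level kriging model in which the observation vector $z_t$ has law $\mathcal N(H_t\lambda_t,\sigma_t^2R_t)$ with $H_t$ a fixed design matrix. So the parameter estimation is that of $s$ independent krigings. -/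

import Mathlib

open MeasureTheory ProbabilityTheory Matrix
open scoped ENNReal NNReal

noncomputable section

namespace CoKriging

/-! ### Bayes formula with possibly improper priors -/

section Bayes

variable {Par Ω E F : Type*} [MeasurableSpace Par] [MeasurableSpace Ω]

/-- Bayes formula: `post = likelihood * prior / evidence`, where `lik` is the likelihood at the
observed data. The prior may be improper (infinite), but the evidence, i.e. the total mass of
`likelihood * prior`, has to be positive and finite. -/
def IsBayesUpdate (prior : Measure Par) (lik : Par → ℝ≥0) (post : Measure Par) : Prop :=
  AEMeasurable lik prior ∧
  (∫⁻ a, (lik a : ℝ≥0∞) ∂prior) ≠ 0 ∧ (∫⁻ a, (lik a : ℝ≥0∞) ∂prior) ≠ ∞ ∧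
  post = (∫⁻ a, (lik a : ℝ≥0∞) ∂prior)⁻¹ • prior.withDensity (fun a => (lik a : ℝ≥0∞))

/-- `post` is the posterior distribution `[a | Y = y]` of the parameter `a` with prior `prior`,
when `P a` is the probability measure on `Ω` given the parameter `a`. The likelihood is the
(unique) continuous version of the probability density `L a` of `Y` under `P a`. -/
def IsPosterior [TopologicalSpace F] [MeasureSpace F] (prior : Measure Par) (P : Par → Measure Ω)
    (Y : Ω → F) (y : F) (post : Measure Par) : Prop :=
  ∃ L : Par → F → ℝ≥0,
    (∀ᵐ a ∂prior, Continuous (L a) ∧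
      (P a).map Y = (volume : Measure F).withDensity (fun b => (L a b : ℝ≥0∞))) ∧
    IsBayesUpdate prior (fun a => L a y) post

/-- `post` is the posterior distribution `[a | Y = y, X = x]` of the parameter `a`, where the
likelihood is the conditional density of `Y` given `X` under `P a`: the continuous `L a` such that
the law of `(X, Y)` is `law(X)(dx) L a (x, y) dy`. As `law(X)` is asked to charge all nonempty open
sets, there is at most one such `L a`. -/
def IsCondPosterior [TopologicalSpace E] [MeasurableSpace E] [TopologicalSpace F] [MeasureSpace F]
    (prior : Measure Par) (P : Par → Measure Ω) (X : Ω → E) (x : E) (Y : Ω → F) (y : F)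
    (post : Measure Par) : Prop :=
  ∃ L : Par → E × F → ℝ≥0,
    (∀ᵐ a ∂prior, ((P a).map X).IsOpenPosMeasure ∧ Continuous (L a) ∧
      (P a).map (fun ω => (X ω, Y ω)) =
        (((P a).map X).prod (volume : Measure F)).withDensity (fun b => (L a b : ℝ≥0∞))) ∧
    IsBayesUpdate prior (fun a => L a (x, y)) post

end Bayes

/-! ### Jeffreys priors, inverse gamma distribution -/

/-- The improper prior `p(v) ∝ 1 / v` on the variance `v > 0`. -/
def jeffreysVariance : Measure ℝ :=
  (volume.restrict (Set.Ioi 0)).withDensity (fun v => ENNReal.ofReal (1 / v))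

/-- The Jeffreys prior on (regression coefficients, variance): flat in the coefficients and
`1 / v` in the variance. -/
def jeffreysPrior (κ : Type*) [Fintype κ] : Measure (EuclideanSpace ℝ κ × ℝ) :=
  (volume : Measure (EuclideanSpace ℝ κ)).prod jeffreysVariance

/-- The inverse gamma distribution `IG(α, Q)`, with density
`Q ^ α / Γ(α) * exp (-Q / x) / x ^ (α + 1)` on `x > 0`. -/
def invGamma (α Q : ℝ) : Measure ℝ :=
  volume.withDensity (fun x => ENNReal.ofReal
    (if 0 < x then Q ^ α / Real.Gamma α * (Real.exp (-(Q / x)) / x ^ (α + 1)) else 0))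

/-! ### Kriging with design matrix `H`, correlation matrix `R` and observations `y` -/

section Kriging

variable {ι κ : Type*} [Fintype ι] [DecidableEq ι] [Fintype κ] [DecidableEq κ]

/-- `(Hᵀ R⁻¹ H)⁻¹` -/
def coefCov (H : Matrix ι κ ℝ) (R : Matrix ι ι ℝ) : Matrix κ κ ℝ :=
  (Hᵀ * R⁻¹ * H)⁻¹

/-- `(Hᵀ R⁻¹ H)⁻¹ Hᵀ R⁻¹ y` -/
def coefMean (H : Matrix ι κ ℝ) (R : Matrix ι ι ℝ) (y : EuclideanSpace ℝ ι) :
    EuclideanSpace ℝ κ :=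
  WithLp.toLp 2 (((Hᵀ * R⁻¹ * H)⁻¹ * Hᵀ * R⁻¹) *ᵥ y.ofLp)

/-- `(y - H b)ᵀ R⁻¹ (y - H b)` with `b = (Hᵀ R⁻¹ H)⁻¹ Hᵀ R⁻¹ y` -/
def residualForm (H : Matrix ι κ ℝ) (R : Matrix ι ι ℝ) (y : EuclideanSpace ℝ ι) : ℝ :=
  (y.ofLp - H *ᵥ (coefMean H R y).ofLp) ⬝ᵥ (R⁻¹ *ᵥ (y.ofLp - H *ᵥ (coefMean H R y).ofLp))

/-- The posterior of (coefficients `b`, variance `v`) announced for a kriging model: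
`v` has law `IG(α, Q / 2)` and, given `v`, the vector `b` has law
`N((Hᵀ R⁻¹ H)⁻¹ Hᵀ R⁻¹ y, v (Hᵀ R⁻¹ H)⁻¹)`. -/
structure IsGaussianInvGamma (H : Matrix ι κ ℝ) (R : Matrix ι ι ℝ) (y : EuclideanSpace ℝ ι)
    (α : ℝ) (post : Measure (EuclideanSpace ℝ κ × ℝ)) : Prop where
  isProbabilityMeasure : IsProbabilityMeasure post
  variance_law : post.map Prod.snd = invGamma α (residualForm H R y / 2)
  coef_law_given_variance : ∀ (A : Set (EuclideanSpace ℝ κ)) (B : Set ℝ),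
    MeasurableSet A → MeasurableSet B →
    post (A ×ˢ B) = ∫⁻ v in B, multivariateGaussian (coefMean H R y) (v • coefCov H R) A
      ∂(invGamma α (residualForm H R y / 2))

/-- The one-level kriging model at the observation points: given the coefficients `b` and the
variance `v`, the observation vector has law `N(H b, v R)`. -/
def krigingLaw (H : Matrix ι κ ℝ) (R : Matrix ι ι ℝ) (a : EuclideanSpace ℝ κ × ℝ) :
    Measure (EuclideanSpace ℝ ι) :=
  multivariateGaussian (WithLp.toLp 2 (H *ᵥ a.1.ofLp)) (a.2 • R)

end Kriging

/-! ### The autoregressive multi-level model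

There are `m + 1` levels, indexed by `Fin (m + 1)`; the level `i.succ` is obtained from the level
`i.castSucc`, for `i : Fin m`. -/

section Model

variable {m d : ℕ}

/-- Parameters: `(β, σ²)` of the first level, and for each transition `i` the pair
`((βρ, β), σ²)` with `βρ` the coefficients of the scale factor between `i.castSucc` and `i.succ`,
and `β`, `σ²` the trend coefficients and the variance of the level `i.succ`. -/
abbrev Params (p : Fin (m + 1) → ℕ) (q : Fin m → ℕ) : Type :=
  (EuclideanSpace ℝ (Fin (p 0)) × ℝ) ×
    ((i : Fin m) → EuclideanSpace ℝ (Fin (q i) ⊕ Fin (p i.succ)) × ℝ)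

variable {p : Fin (m + 1) → ℕ} {q : Fin m → ℕ}

/-- All the variances are positive. -/
def PosVariances (ψ : Params p q) : Prop :=
  0 < ψ.1.2 ∧ ∀ i, 0 < (ψ.2 i).2

/-- Product of the Jeffreys priors of the levels. -/
def paramPrior (p : Fin (m + 1) → ℕ) (q : Fin m → ℕ) : Measure (Params p q) :=
  (jeffreysPrior (Fin (p 0))).prod
    (Measure.pi fun i : Fin m => jeffreysPrior (Fin (q i) ⊕ Fin (p i.succ)))

variable {D : Set (EuclideanSpace ℝ (Fin d))} {Ω : Type*}

/-- The scale factor `ρ(u) = fρ(u)ᵀ βρ` of the transition `i`. -/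
def scale (fρ : (i : Fin m) → D → Fin (q i) → ℝ) (ψ : Params p q) (i : Fin m) (u : D) : ℝ :=
  ∑ k, fρ i u k * (ψ.2 i).1 (Sum.inl k)

/-- The discrepancy process `δ(u) = Z_t(u) - ρ(u) Z_{t-1}(u)` of the transition `i`. -/
def discrepancy (fρ : (i : Fin m) → D → Fin (q i) → ℝ) (Z : Fin (m + 1) → D → Ω → ℝ)
    (ψ : Params p q) (i : Fin m) (u : D) (ω : Ω) : ℝ :=
  Z i.succ u ω - scale fρ ψ i u * Z i.castSucc u ω

/-- Under `P`, the processes `Z` on the domain `D` follow the autoregressive model with parameters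
`ψ`, regression functions `f`, `fρ` and correlation functions `r`. -/
structure IsARModel [MeasurableSpace Ω]
    (f : (t : Fin (m + 1)) → D → Fin (p t) → ℝ) (fρ : (i : Fin m) → D → Fin (q i) → ℝ)
    (r : Fin (m + 1) → EuclideanSpace ℝ (Fin d) → ℝ)
    (Z : Fin (m + 1) → D → Ω → ℝ) (ψ : Params p q) (P : Measure Ω) : Prop where
  isProbabilityMeasure : IsProbabilityMeasure P
  measurable : ∀ t u, Measurable (Z t u)
  first_gaussian : IsGaussianProcess (Z 0) P
  first_mean : ∀ u, ∫ ω, Z 0 u ω ∂P = ∑ k, f 0 u k * ψ.1.1 k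
  first_cov : ∀ u u' : D, covariance (Z 0 u) (Z 0 u') P = ψ.1.2 * r 0 (u - u')
  disc_gaussian : ∀ i, IsGaussianProcess (discrepancy fρ Z ψ i) P
  disc_mean : ∀ i u, ∫ ω, discrepancy fρ Z ψ i u ω ∂P =
    ∑ k, f i.succ u k * (ψ.2 i).1 (Sum.inr k)
  disc_cov : ∀ i (u u' : D), covariance (discrepancy fρ Z ψ i u) (discrepancy fρ Z ψ i u') P =
    (ψ.2 i).2 * r i.succ (u - u')
  disc_indep : ∀ i, IndepFun (fun ω (u : D) => discrepancy fρ Z ψ i u ω)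
    (fun ω (tu : {t : Fin (m + 1) // t ≤ i.castSucc} × D) => Z tu.1 tu.2 ω) P

/-- The correlation matrix `R(x, x)` of the points `x j`. -/
def corrMatrix {n : ℕ} (r : EuclideanSpace ℝ (Fin d) → ℝ) (x : Fin n → D) :
    Matrix (Fin n) (Fin n) ℝ :=
  Matrix.of fun j k => r ((x j : EuclideanSpace ℝ (Fin d)) - x k)

/-- The matrix with rows `g(x j)ᵀ`. -/
def regMatrix {n k : ℕ} (g : D → Fin k → ℝ) (x : Fin n → D) : Matrix (Fin n) (Fin k) ℝ :=
  Matrix.of fun j => g (x j)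

/-- The block matrix `[Fρ ⊙ (w 1ᵀ)  F]`. -/
def coDesign {n a b : ℕ} (Fρ : Matrix (Fin n) (Fin a) ℝ) (w : Fin n → ℝ)
    (F : Matrix (Fin n) (Fin b) ℝ) : Matrix (Fin n) (Fin a ⊕ Fin b) ℝ :=
  Matrix.fromCols (Matrix.of fun j k => Fρ j k * w j) F

/-- The vector `Z_t(D_t)` of the values of the process `Z_t` at the design points. -/
def obs {n : ℕ} (Zt : D → Ω → ℝ) (x : Fin n → D) (ω : Ω) : EuclideanSpace ℝ (Fin n) :=
  WithLp.toLp 2 fun j => Zt (x j) ω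

/-- The parameters `ψ` where the parameters of the transition `i` are replaced by `a`. -/
def replaceLevel (ψ : Params p q) (i : Fin m)
    (a : EuclideanSpace ℝ (Fin (q i) ⊕ Fin (p i.succ)) × ℝ) : Params p q :=
  (ψ.1, Function.update ψ.2 i a)

end Model

end CoKriging

end

/-!
Fix a positive variance `v`. Splitting `y - H b` into the generalized least squares residual and
`H (b̂ - b)`, which are orthogonal for `R⁻¹`, the Gaussian likelihood factors as the density of
`N(b̂, v (Hᵀ R⁻¹ H)⁻¹)` in `b` times a constant multiple of `v ^ (-α) * exp (-Q / (2 v))`. So under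
the flat prior the coefficients have this Gaussian posterior, and the Jeffreys prior `1 / v` on the
variance turns the remaining factor into the density of `IG(α, Q / 2)`.

The discrepancy of a level is independent of the coarser levels, so the observations form a
Gaussian autoregressive chain, and their joint density is the product of the transition densities.
The transition to a level is a kriging likelihood whose design matrix contains the observations of
the preceding level. Each factor involves the parameters of one level only; as the prior is also a
product, so is the posterior.
-/

noncomputable section

namespace CoKriging

section Measure

theorem map_withDensity_comp {α β : Type*} [MeasurableSpace α] [MeasurableSpace β] {μ : Measure α}
    {T : α → β} (hT : Measurable T) {g : β → ℝ≥0∞} (hg : Measurable g) :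
    (μ.withDensity (g ∘ T)).map T = (μ.map T).withDensity g := by
  ext s hs
  rw [Measure.map_apply hT hs, withDensity_apply _ (hT hs), withDensity_apply _ hs,
    setLIntegral_map hs hg hT]
  rfl

theorem lintegral_fin_prod_eq_prod {n : ℕ} {E : Fin n → Type*} [∀ i, MeasurableSpace (E i)]
    (μ : ∀ i, Measure (E i)) [∀ i, SigmaFinite (μ i)] {f : ∀ i, E i → ℝ≥0∞}
    (hf : ∀ i, Measurable (f i)) :
    ∫⁻ x, ∏ i, f i (x i) ∂(Measure.pi μ) = ∏ i, ∫⁻ x, f i x ∂(μ i) := by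
  induction n with
  | zero => simp
  | succ n ih =>
    rw [← ((measurePreserving_piFinSuccAbove μ 0).symm).lintegral_comp_emb
      (MeasurableEquiv.measurableEmbedding _), Fin.prod_univ_succ,
      ← ih (fun i => μ i.succ) fun i => hf i.succ, ← lintegral_prod_mul (hf 0).aemeasurable
      (Finset.measurable_prod _ fun i _ => (hf i.succ).comp (measurable_pi_apply i)).aemeasurable]
    refine lintegral_congr fun y => ?_
    rw [Fin.prod_univ_succ]
    rfl

theorem lintegral_fintype_prod_eq_prod {ι : Type*} [Fintype ι] {E : ι → Type*}
    [∀ i, MeasurableSpace (E i)] (μ : ∀ i, Measure (E i)) [∀ i, SigmaFinite (μ i)]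
    {f : ∀ i, E i → ℝ≥0∞} (hf : ∀ i, Measurable (f i)) :
    ∫⁻ x, ∏ i, f i (x i) ∂(Measure.pi μ) = ∏ i, ∫⁻ x, f i x ∂(μ i) := by
  let e := (Fintype.equivFin ι).symm
  rw [← (measurePreserving_piCongrLeft _ e).lintegral_comp_emb
    (MeasurableEquiv.measurableEmbedding _)]
  simp_rw [← e.prod_comp, MeasurableEquiv.coe_piCongrLeft, Equiv.piCongrLeft_apply_apply]
  exact lintegral_fin_prod_eq_prod (fun i => μ (e i)) fun i => hf (e i)

theorem pi_withDensity {ι : Type*} [Fintype ι] {E : ι → Type*} [∀ i, MeasurableSpace (E i)]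
    (μ : ∀ i, Measure (E i)) [∀ i, SigmaFinite (μ i)] {g : ∀ i, E i → ℝ≥0}
    (hg : ∀ i, Measurable (g i)) :
    Measure.pi (fun i => (μ i).withDensity fun x => (g i x : ℝ≥0∞)) =
      (Measure.pi μ).withDensity (fun x => ((∏ i, g i (x i) : ℝ≥0) : ℝ≥0∞)) := by
  refine Measure.pi_eq fun s hs => ?_
  simp_rw [withDensity_apply _ (MeasurableSet.univ_pi hs), Measure.restrict_pi_pi,
    ENNReal.ofNNReal_finsetProd]
  rw [lintegral_fintype_prod_eq_prod _ fun i => (hg i).coe_nnreal_ennreal]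
  exact Finset.prod_congr rfl fun i _ => (withDensity_apply _ (hs i)).symm

theorem pi_smul {ι : Type*} [Fintype ι] {E : ι → Type*} [∀ i, MeasurableSpace (E i)]
    (c : ι → ℝ≥0) (μ : ∀ i, Measure (E i)) [∀ i, SigmaFinite (μ i)] :
    Measure.pi (fun i => c i • μ i) = (∏ i, c i) • Measure.pi μ := by
  refine Measure.pi_eq fun s _ => ?_
  simp only [Measure.smul_apply, Measure.pi_pi, ENNReal.smul_def, smul_eq_mul,
    Finset.prod_mul_distrib, ENNReal.ofNNReal_finsetProd]

end Measure

section Gaussian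

variable {ι : Type*} [Fintype ι] [DecidableEq ι]

/-- The density at `y` of the Gaussian distribution `N(c, S)`, for a positive definite covariance
matrix `S`. -/
def multivariateGaussianPDFReal (c : EuclideanSpace ℝ ι) (S : Matrix ι ι ℝ)
    (y : EuclideanSpace ℝ ι) : ℝ :=
  (√((2 * Real.pi) ^ Fintype.card ι * S.det))⁻¹ *
    Real.exp (-((y - c).ofLp ⬝ᵥ S⁻¹ *ᵥ (y - c).ofLp / 2))

theorem multivariateGaussianPDFReal_pos {S : Matrix ι ι ℝ} (hS : S.PosDef)
    (c y : EuclideanSpace ℝ ι) : 0 < multivariateGaussianPDFReal c S y := by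
  have := hS.det_pos
  unfold multivariateGaussianPDFReal
  positivity

theorem continuous_multivariateGaussianPDFReal {X : Type*} [TopologicalSpace X]
    (S : Matrix ι ι ℝ) {c y : X → EuclideanSpace ℝ ι} (hc : Continuous c) (hy : Continuous y) :
    Continuous fun a => multivariateGaussianPDFReal (c a) S (y a) := by
  have hres : Continuous fun a => (y a - c a).ofLp := by fun_prop
  have := hres.dotProduct (continuous_const.matrix_mulVec hres (A := fun _ => S⁻¹))
  unfold multivariateGaussianPDFReal
  fun_prop

theorem measurable_multivariateGaussianPDFReal {X : Type*} [TopologicalSpace X] [MeasurableSpace X]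
    [OpensMeasurableSpace X] {S : X → Matrix ι ι ℝ} {c y : X → EuclideanSpace ℝ ι}
    (hc : Continuous c) (hS : Continuous S) (hy : Continuous y) :
    Measurable fun a => multivariateGaussianPDFReal (c a) (S a) (y a) := by
  have hres : Continuous fun a => (y a - c a).ofLp := by fun_prop
  have hform := (hres.dotProduct (hS.matrix_adjugate.matrix_mulVec hres)).measurable
  have hdet := hS.matrix_det.measurable
  -- `S⁻¹` is discontinuous where `S` is singular, but it is a quotient of continuous functions.
  simp only [multivariateGaussianPDFReal, inv_def, Ring.inverse_eq_inv', smul_mulVec,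
    dotProduct_smul, smul_eq_mul]
  fun_prop

theorem prod_gaussianPDFReal_zero_one (x : EuclideanSpace ℝ ι) :
    ∏ i, gaussianPDFReal 0 1 (x i) = multivariateGaussianPDFReal 0 1 x := by
  simp only [gaussianPDFReal, multivariateGaussianPDFReal, Finset.prod_mul_distrib,
    ← Real.exp_sum, Finset.prod_const, Finset.card_univ, NNReal.coe_one, mul_one, sub_zero,
    det_one, inv_one, one_mulVec, dotProduct, Finset.sum_div, Finset.sum_neg_distrib,
    neg_div, ← sq, inv_pow]
  rw [Real.sqrt_eq_rpow, Real.sqrt_eq_rpow, Real.rpow_pow_comm (by positivity)]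

theorem stdGaussian_eq_withDensity :
    stdGaussian (EuclideanSpace ℝ ι) = (volume : Measure (EuclideanSpace ℝ ι)).withDensity
      (fun x => ENNReal.ofReal (multivariateGaussianPDFReal 0 1 x)) := by
  have hmeas : Measurable fun x : EuclideanSpace ℝ ι =>
      ENNReal.ofReal (multivariateGaussianPDFReal 0 1 x) :=
    (continuous_multivariateGaussianPDFReal 1 continuous_const
      continuous_id).measurable.ennreal_ofReal
  have hprod : (fun x : EuclideanSpace ℝ ι =>
      ENNReal.ofReal (multivariateGaussianPDFReal 0 1 x)) ∘ WithLp.toLp 2 =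
      fun x : ι → ℝ => ((∏ i, (gaussianPDFReal 0 1 (x i)).toNNReal : ℝ≥0) : ℝ≥0∞) := by
    funext x
    rw [← Real.toNNReal_prod_of_nonneg fun i _ => gaussianPDFReal_nonneg 0 1 (x i)]
    exact congrArg ENNReal.ofReal (prod_gaussianPDFReal_zero_one (WithLp.toLp 2 x)).symm
  rw [← map_pi_eq_stdGaussian, gaussianReal_of_var_ne_zero 0 one_ne_zero]
  change (Measure.pi fun _ => volume.withDensity fun x =>
    ((gaussianPDFReal 0 1 x).toNNReal : ℝ≥0∞)).map (WithLp.toLp 2) = _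
  rw [pi_withDensity _ fun _ => (measurable_gaussianPDFReal 0 1).real_toNNReal, ← hprod,
    map_withDensity_comp (by fun_prop) hmeas]
  exact congrArg (Measure.withDensity · _)
    (EuclideanSpace.volume_preserving_symm_measurableEquiv_toLp ι).symm.map_eq

theorem map_add_toEuclideanCLM_volume {A : Matrix ι ι ℝ} (hA : A.det ≠ 0)
    (c : EuclideanSpace ℝ ι) :
    (volume : Measure (EuclideanSpace ℝ ι)).map (fun x => c + toEuclideanCLM (𝕜 := ℝ) A x) =
      ENNReal.ofReal |A.det⁻¹| • volume := by
  have hdet : LinearMap.det (toEuclideanCLM (𝕜 := ℝ) A).toLinearMap = A.det := by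
    rw [coe_toEuclideanCLM_eq_toEuclideanLin, toEuclideanLin, toLpLin_eq_toLin,
      LinearMap.det_toLin]
  change volume.map ((c + ·) ∘ (toEuclideanCLM (𝕜 := ℝ) A).toLinearMap) = _
  rw [← Measure.map_map (by fun_prop) (by fun_prop),
    Measure.map_linearMap_addHaar_eq_smul_addHaar _ (by rwa [hdet]), Measure.map_smul, hdet,
    map_add_left_eq_self]

theorem abs_det_mul_multivariateGaussianPDFReal {A S : Matrix ι ι ℝ} (hA : A.det ≠ 0)
    (hS : A * Aᵀ = S) (c x : EuclideanSpace ℝ ι) :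
    |A.det| * multivariateGaussianPDFReal c S (c + toEuclideanCLM (𝕜 := ℝ) A x) =
      multivariateGaussianPDFReal 0 1 x := by
  have hunit : IsUnit A.det := hA.isUnit
  have hform : Aᵀ * S⁻¹ * A = 1 := by
    rw [← hS, Matrix.mul_inv_rev, ← mul_assoc, mul_nonsing_inv _ (by rwa [det_transpose]), one_mul,
      nonsing_inv_mul _ hunit]
  have hsqrt : √((2 * Real.pi) ^ Fintype.card ι * S.det) =
      √((2 * Real.pi) ^ Fintype.card ι) * |A.det| := by
    rw [Real.sqrt_mul (by positivity), ← hS, det_mul, det_transpose, Real.sqrt_mul_self_eq_abs]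
  have hquad : (A *ᵥ x.ofLp) ⬝ᵥ S⁻¹ *ᵥ (A *ᵥ x.ofLp) = x.ofLp ⬝ᵥ x.ofLp := by
    nth_rw 1 [← vecMul_transpose A]
    rw [← dotProduct_mulVec, mulVec_mulVec, mulVec_mulVec, hform, one_mulVec]
  have hres : (c + toEuclideanCLM (𝕜 := ℝ) A x - c).ofLp = A *ᵥ x.ofLp := by simp
  simp only [multivariateGaussianPDFReal, sub_zero, det_one, mul_one, inv_one, one_mulVec]
  rw [hres, hquad, hsqrt, mul_inv, ← mul_assoc, mul_left_comm, mul_inv_cancel₀ (abs_ne_zero.2 hA),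
    mul_one]

open scoped MatrixOrder in
theorem multivariateGaussian_eq_withDensity {S : Matrix ι ι ℝ} (hS : S.PosDef)
    (c : EuclideanSpace ℝ ι) :
    multivariateGaussian c S =
      volume.withDensity (fun y => ENNReal.ofReal (multivariateGaussianPDFReal c S y)) := by
  set A := CFC.sqrt S
  have hAA : A * Aᵀ = S := by
    have hsymm : Aᵀ = A := by simpa using (CFC.sqrt_nonneg S).posSemidef.isHermitian.eq
    rw [hsymm, CFC.sqrt_mul_sqrt_self _ hS.posSemidef.nonneg]
  have hA : A.det ≠ 0 := fun h => hS.det_pos.ne' (by rw [← hAA, det_mul, h, zero_mul])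
  have hmeas : Measurable fun y => ENNReal.ofReal (|A.det| * multivariateGaussianPDFReal c S y) :=
    ((continuous_multivariateGaussianPDFReal S continuous_const
      continuous_id).measurable.const_mul _).ennreal_ofReal
  rw [multivariateGaussian, stdGaussian_eq_withDensity]
  simp_rw [← abs_det_mul_multivariateGaussianPDFReal hA hAA c]
  change (volume.withDensity ((fun y => ENNReal.ofReal (|A.det| *
    multivariateGaussianPDFReal c S y)) ∘ fun x => c + toEuclideanCLM (𝕜 := ℝ) A x)).map _ = _
  rw [map_withDensity_comp (by fun_prop) hmeas, map_add_toEuclideanCLM_volume hA,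
    withDensity_smul_measure, ← withDensity_smul _ hmeas]
  congr with y
  rw [Pi.smul_apply, smul_eq_mul, ← ENNReal.ofReal_mul (abs_nonneg _), ← mul_assoc, ← abs_mul,
    inv_mul_cancel₀ hA, abs_one, one_mul]

theorem map_eq_multivariateGaussian {Ω : Type*} [MeasurableSpace Ω] {P : Measure Ω}
    {X : Ω → EuclideanSpace ℝ ι} (hX : HasGaussianLaw X P) {c : EuclideanSpace ℝ ι}
    {S : Matrix ι ι ℝ} (hS : S.PosSemidef) (hmean : ∀ j, ∫ ω, X ω j ∂P = c j)
    (hcov : ∀ j k, covariance (fun ω => X ω j) (fun ω => X ω k) P = S j k) :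
    P.map X = multivariateGaussian c S := by
  have := hX.isGaussian_map
  have hm := hX.aemeasurable
  apply IsGaussian.ext
  · rw [integral_id_multivariateGaussian', integral_map hm (by fun_prop)]
    ext j
    rw [← hmean j]
    exact ((EuclideanSpace.proj (𝕜 := ℝ) j).integral_comp_comm hX.integrable).symm
  · rw [← ContinuousLinearMap.toBilinForm_inj]
    refine LinearMap.BilinForm.ext_basis (EuclideanSpace.basisFun ι ℝ).toBasis fun j k => ?_
    have hcoord (j : ι) : (fun u => inner ℝ ((EuclideanSpace.basisFun ι ℝ).toBasis j) u) ∘ X =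
        fun ω => X ω j := by
      ext; simp [PiLp.inner_apply]
    rw [ContinuousLinearMap.toBilinForm_apply, ContinuousLinearMap.toBilinForm_apply,
      covarianceBilin_apply_eq_cov IsGaussian.memLp_two_id, covariance_map (by fun_prop)
      (by fun_prop) hm, hcoord, hcoord, hcov, covarianceBilin_multivariateGaussian hS]
    simp

theorem map_toLp_eq_multivariateGaussian {Ω T : Type*} [MeasurableSpace Ω] {P : Measure Ω}
    {X : T → Ω → ℝ} (hX : IsGaussianProcess X P) (x : ι → T) {c : EuclideanSpace ℝ ι}
    {S : Matrix ι ι ℝ} (hS : S.PosSemidef) (hmean : ∀ j, ∫ ω, X (x j) ω ∂P = c j)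
    (hcov : ∀ j k, covariance (X (x j)) (X (x k)) P = S j k) :
    P.map (fun ω => (WithLp.toLp 2 fun j => X (x j) ω : EuclideanSpace ℝ ι)) =
      multivariateGaussian c S := by
  let L : (↥(Finset.univ : Finset ι) → ℝ) →L[ℝ] ι → ℝ :=
    ContinuousLinearMap.pi fun j => ContinuousLinearMap.proj ⟨j, Finset.mem_univ j⟩
  have hpi : HasGaussianLaw (fun ω j => X (x j) ω) P :=
    ((hX.comp_right x).hasGaussianLaw Finset.univ).map L
  exact map_eq_multivariateGaussian (hpi.toLp_pi 2) hS hmean hcov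

end Gaussian

section Bayes

variable {α β : Type*} [MeasurableSpace α] [MeasurableSpace β]

theorem isBayesUpdate_iff {prior post : Measure α} {lik : α → ℝ≥0} :
    IsBayesUpdate prior lik post ↔ AEMeasurable lik prior ∧ IsProbabilityMeasure post ∧
      ∃ c : ℝ≥0, c ≠ 0 ∧ prior.withDensity (fun a => (lik a : ℝ≥0∞)) = c • post := by
  have hmass : ∫⁻ a, (lik a : ℝ≥0∞) ∂prior =
      prior.withDensity (fun a => (lik a : ℝ≥0∞)) Set.univ := by simp
  constructor
  · rintro ⟨hlik, h0, htop, rfl⟩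
    refine ⟨hlik, ⟨?_⟩, (∫⁻ a, (lik a : ℝ≥0∞) ∂prior).toNNReal, ?_, ?_⟩
    · simp [ENNReal.inv_mul_cancel h0 htop]
    · simp [ENNReal.toNNReal_eq_zero_iff, h0, htop]
    · rw [ENNReal.smul_def, ENNReal.coe_toNNReal htop, smul_smul, ENNReal.mul_inv_cancel h0 htop,
        one_smul]
  · rintro ⟨hlik, hpost, c, hc, heq⟩
    have hmass_eq : ∫⁻ a, (lik a : ℝ≥0∞) ∂prior = c := by
      rw [hmass, heq, Measure.smul_apply, measure_univ, ENNReal.smul_def, smul_eq_mul, mul_one]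
    rw [IsBayesUpdate, hmass_eq, heq, ENNReal.smul_def, smul_smul,
      ENNReal.inv_mul_cancel (by simpa) (by simp), one_smul]
    simp [hlik, hc]

theorem IsBayesUpdate.prod {μ post : Measure α} {ν post' : Measure β} [SigmaFinite μ]
    [SigmaFinite ν] {l : α → ℝ≥0} {l' : β → ℝ≥0} (hl : Measurable l) (hl' : Measurable l')
    (h : IsBayesUpdate μ l post) (h' : IsBayesUpdate ν l' post') :
    IsBayesUpdate (μ.prod ν) (fun a => l a.1 * l' a.2) (post.prod post') := by
  obtain ⟨-, _, c, hc, heq⟩ := isBayesUpdate_iff.1 h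
  obtain ⟨-, _, c', hc', heq'⟩ := isBayesUpdate_iff.1 h'
  refine isBayesUpdate_iff.2 ⟨by fun_prop, inferInstance, c * c', mul_ne_zero hc hc', ?_⟩
  simp_rw [ENNReal.coe_mul]
  rw [← prod_withDensity hl.coe_nnreal_ennreal hl'.coe_nnreal_ennreal, heq, heq',
    Measure.prod_smul_left, Measure.prod_smul_right, smul_smul]

theorem IsBayesUpdate.pi {ι : Type*} [Fintype ι] {E : ι → Type*} [∀ i, MeasurableSpace (E i)]
    {μ post : ∀ i, Measure (E i)} [∀ i, SigmaFinite (μ i)] {l : ∀ i, E i → ℝ≥0}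
    (hl : ∀ i, Measurable (l i)) (h : ∀ i, IsBayesUpdate (μ i) (l i) (post i)) :
    IsBayesUpdate (Measure.pi μ) (fun a => ∏ i, l i (a i)) (Measure.pi post) := by
  choose _ _ c hc heq using fun i => isBayesUpdate_iff.1 (h i)
  refine isBayesUpdate_iff.2
    ⟨?_, inferInstance, ∏ i, c i, Finset.prod_ne_zero_iff.2 fun i _ => hc i, ?_⟩
  · exact (Finset.measurable_prod _ fun i _ => (hl i).comp (measurable_pi_apply i)).aemeasurable
  · rw [← pi_withDensity μ hl, funext heq, pi_smul]

end Bayes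

section InvGamma

theorem invGamma_eq_restrict_withDensity (α Q : ℝ) :
    invGamma α Q = (volume.restrict (Set.Ioi 0)).withDensity (fun x => ENNReal.ofReal
      (Q ^ α / Real.Gamma α * (Real.exp (-(Q / x)) / x ^ (α + 1)))) := by
  rw [invGamma, ← withDensity_indicator measurableSet_Ioi]
  congr 1
  funext x
  by_cases hx : 0 < x <;> simp [Set.indicator, hx]

theorem setLIntegral_Ioi_inv_sq_mul_comp_inv (g : ℝ → ℝ≥0∞) :
    ∫⁻ x in Set.Ioi 0, ENNReal.ofReal (x ^ 2)⁻¹ * g x⁻¹ = ∫⁻ x in Set.Ioi 0, g x := by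
  have himage : (fun x : ℝ => x⁻¹) '' Set.Ioi 0 = Set.Ioi 0 := by
    ext x
    rw [Set.image_inv_eq_inv, Set.mem_inv, Set.mem_Ioi, Set.mem_Ioi, inv_pos]
  have hderiv (x : ℝ) (hx : x ∈ Set.Ioi 0) :
      HasDerivWithinAt (fun x : ℝ => x⁻¹) (-(x ^ 2)⁻¹) (Set.Ioi 0) x :=
    (hasDerivAt_inv (ne_of_gt hx)).hasDerivWithinAt
  conv_rhs => rw [← himage, lintegral_image_eq_lintegral_abs_deriv_mul measurableSet_Ioi hderiv
    inv_injective.injOn]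
  simp only [abs_neg, abs_inv, abs_sq]

theorem isProbabilityMeasure_invGamma {α Q : ℝ} (hα : 0 < α) (hQ : 0 < Q) :
    IsProbabilityMeasure (invGamma α Q) := by
  have hgamma : ∫⁻ x in Set.Ioi 0, gammaPDF α Q x = 1 := by
    have hneg : ∫⁻ x in Set.Iic 0, gammaPDF α Q x = 0 := by
      rw [setLIntegral_congr Iio_ae_eq_Iic.symm]
      exact lintegral_gammaPDF_of_nonpos le_rfl
    have hsplit := lintegral_add_compl (μ := volume) (gammaPDF α Q) (measurableSet_Ioi (a := 0))
    rwa [Set.compl_Ioi, hneg, add_zero, lintegral_gammaPDF_eq_one hα hQ] at hsplit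
  constructor
  rw [invGamma_eq_restrict_withDensity, withDensity_apply _ MeasurableSet.univ,
    Measure.restrict_univ, ← hgamma, ← setLIntegral_Ioi_inv_sq_mul_comp_inv (gammaPDF α Q)]
  refine setLIntegral_congr_fun measurableSet_Ioi fun x (hx : 0 < x) => ?_
  have hxi : 0 ≤ x⁻¹ := by positivity
  rw [gammaPDF_of_nonneg hxi, ← ENNReal.ofReal_mul (by positivity), ← div_eq_mul_inv Q x,
    Real.inv_rpow hx.le, Real.rpow_add_one hx.ne', Real.rpow_sub_one hx.ne']
  congr 1
  field_simp

end InvGamma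

section JeffreysPrior

instance : SigmaFinite jeffreysVariance :=
  inferInstanceAs (SigmaFinite ((volume.restrict (Set.Ioi (0 : ℝ))).withDensity
    fun v => ((1 / v).toNNReal : ℝ≥0∞)))

instance (κ : Type*) [Fintype κ] : SigmaFinite (jeffreysPrior κ) :=
  inferInstanceAs (SigmaFinite ((volume : Measure (EuclideanSpace ℝ κ)).prod jeffreysVariance))

theorem ae_pos_jeffreysVariance : ∀ᵐ v ∂jeffreysVariance, 0 < v :=
  (withDensity_absolutelyContinuous _ _).ae_le (ae_restrict_mem measurableSet_Ioi)

theorem ae_pos_jeffreysPrior (κ : Type*) [Fintype κ] : ∀ᵐ a ∂jeffreysPrior κ, 0 < a.2 :=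
  Measure.quasiMeasurePreserving_snd.ae ae_pos_jeffreysVariance

end JeffreysPrior

section Kriging

theorem card_lt_card_of_not_exists_mulVec_eq {ι κ : Type*} [Fintype ι] [Fintype κ]
    {H : Matrix ι κ ℝ} (hH : LinearIndependent ℝ H.col) {y : ι → ℝ}
    (hy : ¬ ∃ b : κ → ℝ, y = H *ᵥ b) : Fintype.card κ < Fintype.card ι := by
  have hinj : Function.Injective H.mulVecLin := mulVec_injective_iff.2 hH
  have hle := LinearMap.finrank_le_finrank_of_injective hinj
  simp only [Module.finrank_fintype_fun_eq_card] at hle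
  refine lt_of_le_of_ne hle fun heq => hy ?_
  exact ((LinearMap.injective_iff_surjective_of_finrank_eq_finrank (by simpa using heq)).1 hinj
    y).imp fun _ => Eq.symm

theorem half_card_sub_card_pos {ι κ : Type*} [Fintype ι] [Fintype κ] {H : Matrix ι κ ℝ}
    (hH : LinearIndependent ℝ H.col) {y : ι → ℝ} (hy : ¬ ∃ b : κ → ℝ, y = H *ᵥ b) :
    0 < ((Fintype.card ι : ℝ) - Fintype.card κ) / 2 :=
  half_pos (sub_pos.2 (Nat.cast_lt.2 (card_lt_card_of_not_exists_mulVec_eq hH hy)))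

theorem matrix_inv_smul {ι K : Type*} [Fintype ι] [DecidableEq ι] [Field K] {v : K} (hv : v ≠ 0)
    (A : Matrix ι ι K) : (v • A)⁻¹ = v⁻¹ • A⁻¹ := by
  by_cases hA : IsUnit A.det
  · exact Matrix.inv_smul' A (Units.mk0 v hv) hA
  · have hvA : ¬ IsUnit (v • A).det := by
      simpa [det_smul, hv] using hA
    rw [nonsing_inv_apply_not_isUnit _ hA, nonsing_inv_apply_not_isUnit _ hvA, smul_zero]

theorem posDef_transpose_mul_inv_mul {ι κ : Type*} [Fintype ι] [DecidableEq ι] [Finite κ]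
    {H : Matrix ι κ ℝ} {S : Matrix ι ι ℝ} (hS : S.PosDef) (hH : LinearIndependent ℝ H.col) :
    (Hᵀ * S⁻¹ * H).PosDef := by
  have := Fintype.ofFinite κ
  simpa using hS.inv.conjTranspose_mul_mul_same (B := H) (mulVec_injective_iff.2 hH)

variable {ι κ : Type*} [Fintype ι] [DecidableEq ι] [Fintype κ] [DecidableEq κ]
  {H : Matrix ι κ ℝ} {R S : Matrix ι ι ℝ}

theorem posDef_coefCov (hS : S.PosDef) (hH : LinearIndependent ℝ H.col) : (coefCov H S).PosDef :=
  (posDef_transpose_mul_inv_mul hS hH).inv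

theorem coefCov_smul {v : ℝ} (hv : v ≠ 0) (H : Matrix ι κ ℝ) (R : Matrix ι ι ℝ) :
    coefCov H (v • R) = v • coefCov H R := by
  simp only [coefCov, matrix_inv_smul hv, Matrix.mul_smul, Matrix.smul_mul,
    matrix_inv_smul (inv_ne_zero hv), inv_inv]

theorem coefMean_smul {v : ℝ} (hv : v ≠ 0) (H : Matrix ι κ ℝ) (R : Matrix ι ι ℝ)
    (y : EuclideanSpace ℝ ι) : coefMean H (v • R) y = coefMean H R y := by
  simp only [coefMean, matrix_inv_smul hv, Matrix.mul_smul, Matrix.smul_mul,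
    matrix_inv_smul (inv_ne_zero hv), inv_inv, smul_smul, inv_mul_cancel₀ hv, one_smul]

theorem residualForm_smul {v : ℝ} (hv : v ≠ 0) (H : Matrix ι κ ℝ) (R : Matrix ι ι ℝ)
    (y : EuclideanSpace ℝ ι) : residualForm H (v • R) y = residualForm H R y / v := by
  rw [residualForm, coefMean_smul hv, matrix_inv_smul hv, smul_mulVec, dotProduct_smul,
    smul_eq_mul, ← residualForm, div_eq_inv_mul]

theorem residualForm_pos (hS : S.PosDef) {y : EuclideanSpace ℝ ι}
    (hy : ¬ ∃ b : κ → ℝ, y.ofLp = H *ᵥ b) : 0 < residualForm H S y := by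
  simpa [residualForm] using hS.inv.dotProduct_mulVec_pos
    (x := y.ofLp - H *ᵥ (coefMean H S y).ofLp) fun h => hy ⟨_, sub_eq_zero.1 h⟩

theorem transpose_mulVec_inv_mulVec_residual (hS : S.PosDef) (hH : LinearIndependent ℝ H.col)
    (y : EuclideanSpace ℝ ι) :
    Hᵀ *ᵥ (S⁻¹ *ᵥ (y.ofLp - H *ᵥ (coefMean H S y).ofLp)) = 0 := by
  have hunit : IsUnit (Hᵀ * S⁻¹ * H).det := (posDef_transpose_mul_inv_mul hS hH).det_pos.ne'.isUnit
  rw [mulVec_mulVec, mulVec_sub, mulVec_mulVec, coefMean, mulVec_mulVec,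
    Matrix.mul_assoc _ Hᵀ, mul_nonsing_inv_cancel_left _ _ hunit, sub_self]

theorem dotProduct_inv_mulVec_residual_add (hS : S.PosDef) (hH : LinearIndependent ℝ H.col)
    (y : EuclideanSpace ℝ ι) (b : EuclideanSpace ℝ κ) :
    (y - WithLp.toLp 2 (H *ᵥ b.ofLp)).ofLp ⬝ᵥ S⁻¹ *ᵥ (y - WithLp.toLp 2 (H *ᵥ b.ofLp)).ofLp =
      residualForm H S y + (b - coefMean H S y).ofLp ⬝ᵥ
        (coefCov H S)⁻¹ *ᵥ (b - coefMean H S y).ofLp := by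
  have hunit : IsUnit (Hᵀ * S⁻¹ * H).det := (posDef_transpose_mul_inv_mul hS hH).det_pos.ne'.isUnit
  have hsymm : (S⁻¹)ᵀ = S⁻¹ := by simpa using hS.inv.isHermitian.eq
  have horth := transpose_mulVec_inv_mulVec_residual hS hH y
  rw [residualForm, coefCov, nonsing_inv_nonsing_inv _ hunit]
  set c := (coefMean H S y).ofLp
  set w := y.ofLp - H *ᵥ c
  set u := (b - coefMean H S y).ofLp with hu
  have hsplit : (y - WithLp.toLp 2 (H *ᵥ b.ofLp)).ofLp = w - H *ᵥ u := by
    simp only [w, hu, WithLp.ofLp_sub, mulVec_sub, c]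
    abel
  have hadj (x : ι → ℝ) : (H *ᵥ u) ⬝ᵥ x = u ⬝ᵥ (Hᵀ *ᵥ x) := by
    rw [mulVec_transpose, dotProduct_comm u, ← dotProduct_mulVec, dotProduct_comm]
  have hcross : w ⬝ᵥ S⁻¹ *ᵥ (H *ᵥ u) = (H *ᵥ u) ⬝ᵥ S⁻¹ *ᵥ w := by
    rw [dotProduct_mulVec, ← mulVec_transpose, hsymm, dotProduct_comm]
  rw [hsplit, mulVec_sub, sub_dotProduct, dotProduct_sub, dotProduct_sub, hcross, hadj, hadj,
    horth, mulVec_mulVec, mulVec_mulVec, dotProduct_zero]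
  ring

/-- The likelihood of the observation `y` under `N(H b, S)`, integrated over a flat prior on the
regression coefficients `b`. -/
def integratedLik (H : Matrix ι κ ℝ) (S : Matrix ι ι ℝ) (y : EuclideanSpace ℝ ι) : ℝ :=
  √((2 * Real.pi) ^ Fintype.card κ * (coefCov H S).det) /
    √((2 * Real.pi) ^ Fintype.card ι * S.det) * Real.exp (-(residualForm H S y / 2))

theorem integratedLik_pos (hS : S.PosDef) (hH : LinearIndependent ℝ H.col)
    (y : EuclideanSpace ℝ ι) : 0 < integratedLik H S y := by
  have := hS.det_pos
  have := (posDef_coefCov hS hH).det_pos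
  unfold integratedLik
  positivity

theorem multivariateGaussianPDFReal_mulVec (hS : S.PosDef) (hH : LinearIndependent ℝ H.col)
    (y : EuclideanSpace ℝ ι) (b : EuclideanSpace ℝ κ) :
    multivariateGaussianPDFReal (WithLp.toLp 2 (H *ᵥ b.ofLp)) S y =
      integratedLik H S y * multivariateGaussianPDFReal (coefMean H S y) (coefCov H S) b := by
  have hdet := (posDef_coefCov hS hH).det_pos
  have : 0 < √((2 * Real.pi) ^ Fintype.card κ * (coefCov H S).det) := by positivity
  unfold multivariateGaussianPDFReal integratedLik
  rw [dotProduct_inv_mulVec_residual_add hS hH, add_div, neg_add, Real.exp_add]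
  field_simp

theorem withDensity_multivariateGaussianPDFReal_mulVec (hS : S.PosDef)
    (hH : LinearIndependent ℝ H.col) (y : EuclideanSpace ℝ ι) :
    (volume : Measure (EuclideanSpace ℝ κ)).withDensity (fun b =>
        ENNReal.ofReal (multivariateGaussianPDFReal (WithLp.toLp 2 (H *ᵥ b.ofLp)) S y)) =
      (integratedLik H S y).toNNReal • multivariateGaussian (coefMean H S y) (coefCov H S) := by
  simp_rw [multivariateGaussianPDFReal_mulVec hS hH,
    ENNReal.ofReal_mul (integratedLik_pos hS hH y).le]
  rw [multivariateGaussian_eq_withDensity (posDef_coefCov hS hH)]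
  exact withDensity_smul' _ _ ENNReal.ofReal_ne_top

/-- The density at `y` of `N(H b, v R)`, as a function of `(b, v)`. -/
def krigingLik (H : Matrix ι κ ℝ) (R : Matrix ι ι ℝ) (y : EuclideanSpace ℝ ι)
    (a : EuclideanSpace ℝ κ × ℝ) : ℝ≥0 :=
  (multivariateGaussianPDFReal (WithLp.toLp 2 (H *ᵥ a.1.ofLp)) (a.2 • R) y).toNNReal

theorem measurable_krigingLik {ι κ : Type*} [Fintype ι] [DecidableEq ι] [Fintype κ]
    (H : Matrix ι κ ℝ) (R : Matrix ι ι ℝ) (y : EuclideanSpace ℝ ι) :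
    Measurable (krigingLik H R y) :=
  (measurable_multivariateGaussianPDFReal (by fun_prop) (by fun_prop)
    continuous_const).real_toNNReal

theorem withDensity_krigingLik (hR : R.PosDef) (hH : LinearIndependent ℝ H.col)
    (y : EuclideanSpace ℝ ι) {v : ℝ} (hv : 0 < v) :
    (volume : Measure (EuclideanSpace ℝ κ)).withDensity
        (fun b => (krigingLik H R y (b, v) : ℝ≥0∞)) =
      (integratedLik H (v • R) y).toNNReal •
        multivariateGaussian (coefMean H R y) (v • coefCov H R) := by
  rw [← coefMean_smul hv.ne', ← coefCov_smul hv.ne']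
  exact withDensity_multivariateGaussianPDFReal_mulVec (hR.smul hv) hH y

theorem isBayesUpdate_krigingLik (hR : R.PosDef) (hH : LinearIndependent ℝ H.col)
    (y : EuclideanSpace ℝ ι) {v : ℝ} (hv : 0 < v) :
    IsBayesUpdate volume (fun b => krigingLik H R y (b, v))
      (multivariateGaussian (coefMean H R y) (v • coefCov H R)) :=
  isBayesUpdate_iff.2 ⟨((measurable_krigingLik H R y).comp measurable_prodMk_right).aemeasurable,
    inferInstance, _, (Real.toNNReal_pos.2 (integratedLik_pos (hR.smul hv) hH y)).ne',
    withDensity_krigingLik hR hH y hv⟩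

theorem integratedLik_smul (hR : R.PosDef) {v : ℝ} (hv : 0 < v) (H : Matrix ι κ ℝ)
    (y : EuclideanSpace ℝ ι) :
    integratedLik H (v • R) y =
      √((2 * Real.pi) ^ Fintype.card κ * (coefCov H R).det) /
        √((2 * Real.pi) ^ Fintype.card ι * R.det) *
        (v ^ (((Fintype.card ι : ℝ) - Fintype.card κ) / 2))⁻¹ *
        Real.exp (-(residualForm H R y / 2 / v)) := by
  have hsqrt (k : ℕ) (a : ℝ) : √((2 * Real.pi) ^ k * (v ^ k * a)) =
      v ^ ((k : ℝ) / 2) * √((2 * Real.pi) ^ k * a) := by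
    rw [mul_left_comm, Real.sqrt_mul (by positivity), Real.sqrt_eq_rpow (v ^ k),
      ← Real.rpow_natCast_mul hv.le]
    ring_nf
  have hdet := hR.det_pos
  rw [integratedLik, residualForm_smul hv.ne', coefCov_smul hv.ne', det_smul, det_smul, hsqrt,
    hsqrt, div_right_comm, sub_div, Real.rpow_sub hv]
  field_simp

end Kriging

section JeffreysPosterior

variable {ι κ : Type*} [Fintype ι] [DecidableEq ι] [Fintype κ] [DecidableEq κ]
  {H : Matrix ι κ ℝ} {R : Matrix ι ι ℝ} {y : EuclideanSpace ℝ ι} {α : ℝ}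

/-- The total mass of likelihood times Jeffreys prior in the kriging model, when `α` is half the
number of observations minus half the number of regression coefficients. -/
def evidence (H : Matrix ι κ ℝ) (R : Matrix ι ι ℝ) (y : EuclideanSpace ℝ ι) (α : ℝ) : ℝ :=
  √((2 * Real.pi) ^ Fintype.card κ * (coefCov H R).det) /
    √((2 * Real.pi) ^ Fintype.card ι * R.det) *
    (Real.Gamma α / (residualForm H R y / 2) ^ α)

theorem evidence_pos (hR : R.PosDef) (hH : LinearIndependent ℝ H.col)
    (hy : ¬ ∃ b : κ → ℝ, y.ofLp = H *ᵥ b) (hα : 0 < α) : 0 < evidence H R y α := by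
  have := residualForm_pos hR hy
  have := Real.Gamma_pos_of_pos hα
  have := hR.det_pos
  have := (posDef_coefCov hR hH).det_pos
  unfold evidence
  positivity

theorem inv_mul_integratedLik_smul (hR : R.PosDef) (hH : LinearIndependent ℝ H.col)
    (hy : ¬ ∃ b : κ → ℝ, y.ofLp = H *ᵥ b) (hα : α = ((Fintype.card ι : ℝ) - Fintype.card κ) / 2)
    {v : ℝ} (hv : 0 < v) :
    1 / v * integratedLik H (v • R) y = evidence H R y α *
      ((residualForm H R y / 2) ^ α / Real.Gamma α *
        (Real.exp (-(residualForm H R y / 2 / v)) / v ^ (α + 1))) := by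
  have hGamma := Real.Gamma_pos_of_pos (hα ▸ half_card_sub_card_pos hH hy)
  have hQ : 0 < (residualForm H R y / 2) ^ α :=
    Real.rpow_pos_of_pos (half_pos (residualForm_pos hR hy)) α
  rw [integratedLik_smul hR hv, ← hα, evidence, Real.rpow_add_one hv.ne']
  field_simp

theorem aemeasurable_integratedLik_smul (hR : R.PosDef) :
    AEMeasurable (fun v => integratedLik H (v • R) y) jeffreysVariance :=
  ⟨_, by fun_prop, ae_pos_jeffreysVariance.mono fun _ hv => integratedLik_smul hR hv H y⟩

theorem withDensity_integratedLik_smul (hR : R.PosDef) (hH : LinearIndependent ℝ H.col)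
    (hy : ¬ ∃ b : κ → ℝ, y.ofLp = H *ᵥ b)
    (hα : α = ((Fintype.card ι : ℝ) - Fintype.card κ) / 2) :
    jeffreysVariance.withDensity (fun v => ENNReal.ofReal (integratedLik H (v • R) y)) =
      ENNReal.ofReal (evidence H R y α) • invGamma α (residualForm H R y / 2) := by
  have hα0 : 0 < α := hα ▸ half_card_sub_card_pos hH hy
  have hac : (volume.restrict (Set.Ioi 0)).AbsolutelyContinuous jeffreysVariance := by
    refine withDensity_absolutelyContinuous' (by fun_prop) ?_
    filter_upwards [ae_restrict_mem measurableSet_Ioi] with v (hv : 0 < v)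
    simpa
  rw [jeffreysVariance, ← withDensity_mul₀ (by fun_prop)
    ((aemeasurable_integratedLik_smul hR).mono_ac hac).ennreal_ofReal,
    invGamma_eq_restrict_withDensity, ← withDensity_smul' _ _ ENNReal.ofReal_ne_top]
  refine withDensity_congr_ae ?_
  filter_upwards [ae_restrict_mem measurableSet_Ioi] with v (hv : 0 < v)
  rw [Pi.mul_apply, Pi.smul_apply, smul_eq_mul, ← ENNReal.ofReal_mul (by positivity),
    ← ENNReal.ofReal_mul (evidence_pos hR hH hy hα0).le, inv_mul_integratedLik_smul hR hH hy hα hv]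

theorem jeffreysPrior_withDensity_krigingLik_prod (hR : R.PosDef) (hH : LinearIndependent ℝ H.col)
    (hy : ¬ ∃ b : κ → ℝ, y.ofLp = H *ᵥ b) (hα : α = ((Fintype.card ι : ℝ) - Fintype.card κ) / 2)
    {A : Set (EuclideanSpace ℝ κ)} (hA : MeasurableSet A) {B : Set ℝ} (hB : MeasurableSet B) :
    (jeffreysPrior κ).withDensity (fun a => (krigingLik H R y a : ℝ≥0∞)) (A ×ˢ B) =
      ENNReal.ofReal (evidence H R y α) *
        ∫⁻ v in B, multivariateGaussian (coefMean H R y) (v • coefCov H R) A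
          ∂(invGamma α (residualForm H R y / 2)) := by
  have hlik := (measurable_krigingLik H R y).coe_nnreal_ennreal
  calc (jeffreysPrior κ).withDensity (fun a => (krigingLik H R y a : ℝ≥0∞)) (A ×ˢ B)
    _ = ∫⁻ v in B, (∫⁻ b in A, krigingLik H R y (b, v)) ∂jeffreysVariance := by
      rw [withDensity_apply _ (hA.prod hB), jeffreysPrior, ← Measure.prod_restrict,
        lintegral_prod_symm' _ hlik]
    _ = ∫⁻ v in B, ENNReal.ofReal (integratedLik H (v • R) y) *
          multivariateGaussian (coefMean H R y) (v • coefCov H R) A ∂jeffreysVariance := by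
      refine lintegral_congr_ae (ae_restrict_of_ae ?_)
      filter_upwards [ae_pos_jeffreysVariance] with v hv
      rw [← withDensity_apply _ hA, withDensity_krigingLik hR hH y hv]
      rfl
    _ = ∫⁻ v in B, multivariateGaussian (coefMean H R y) (v • coefCov H R) A
          ∂(jeffreysVariance.withDensity fun v => ENNReal.ofReal (integratedLik H (v • R) y)) :=
      (setLIntegral_withDensity_eq_setLIntegral_mul_non_measurable₀ _
        (aemeasurable_integratedLik_smul hR).ennreal_ofReal.restrict _ hB
        (ae_of_all _ fun _ => ENNReal.ofReal_lt_top)).symm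
    _ = _ := by
      rw [withDensity_integratedLik_smul hR hH hy hα, Measure.restrict_smul,
        lintegral_smul_measure, smul_eq_mul]

/-- The joint posterior of the regression coefficients and the variance in the kriging model with
design matrix `H`, correlation matrix `R` and observations `y`, under the Jeffreys prior. -/
def jeffreysPosterior (H : Matrix ι κ ℝ) (R : Matrix ι ι ℝ) (y : EuclideanSpace ℝ ι) :
    Measure (EuclideanSpace ℝ κ × ℝ) :=
  (∫⁻ a, (krigingLik H R y a : ℝ≥0∞) ∂jeffreysPrior κ)⁻¹ •
    (jeffreysPrior κ).withDensity fun a => (krigingLik H R y a : ℝ≥0∞)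

theorem lintegral_krigingLik_jeffreysPrior (hR : R.PosDef) (hH : LinearIndependent ℝ H.col)
    (hy : ¬ ∃ b : κ → ℝ, y.ofLp = H *ᵥ b)
    (hα : α = ((Fintype.card ι : ℝ) - Fintype.card κ) / 2) :
    ∫⁻ a, (krigingLik H R y a : ℝ≥0∞) ∂jeffreysPrior κ = ENNReal.ofReal (evidence H R y α) := by
  have := isProbabilityMeasure_invGamma (hα ▸ half_card_sub_card_pos hH hy)
    (half_pos (residualForm_pos hR hy))
  rw [← setLIntegral_univ, ← withDensity_apply _ MeasurableSet.univ, ← Set.univ_prod_univ,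
    jeffreysPrior_withDensity_krigingLik_prod hR hH hy hα MeasurableSet.univ MeasurableSet.univ]
  simp

omit [DecidableEq κ] in
theorem isBayesUpdate_jeffreysPosterior (hR : R.PosDef) (hH : LinearIndependent ℝ H.col)
    (hy : ¬ ∃ b : κ → ℝ, y.ofLp = H *ᵥ b) :
    IsBayesUpdate (jeffreysPrior κ) (krigingLik H R y) (jeffreysPosterior H R y) := by
  classical
  have hmass := lintegral_krigingLik_jeffreysPrior hR hH hy rfl
  have hpos := evidence_pos hR hH hy (half_card_sub_card_pos hH hy)
  exact ⟨(measurable_krigingLik H R y).aemeasurable, by simpa [hmass] using hpos, by simp [hmass],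
    rfl⟩

theorem isGaussianInvGamma_jeffreysPosterior (hR : R.PosDef) (hH : LinearIndependent ℝ H.col)
    (hy : ¬ ∃ b : κ → ℝ, y.ofLp = H *ᵥ b)
    (hα : α = ((Fintype.card ι : ℝ) - Fintype.card κ) / 2) :
    IsGaussianInvGamma H R y α (jeffreysPosterior H R y) := by
  have hrect {A : Set (EuclideanSpace ℝ κ)} {B : Set ℝ} (hA : MeasurableSet A)
      (hB : MeasurableSet B) : jeffreysPosterior H R y (A ×ˢ B) =
      ∫⁻ v in B, multivariateGaussian (coefMean H R y) (v • coefCov H R) A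
        ∂(invGamma α (residualForm H R y / 2)) := by
    have hpos := evidence_pos hR hH hy (hα ▸ half_card_sub_card_pos hH hy)
    rw [jeffreysPosterior, lintegral_krigingLik_jeffreysPrior hR hH hy hα, Measure.smul_apply,
      jeffreysPrior_withDensity_krigingLik_prod hR hH hy hα hA hB, smul_eq_mul, ← mul_assoc,
      ENNReal.inv_mul_cancel (by simpa using hpos) ENNReal.ofReal_ne_top, one_mul]
  refine ⟨(isBayesUpdate_iff.1 (isBayesUpdate_jeffreysPosterior hR hH hy)).2.1, ?_,
    fun A B => hrect⟩
  ext B hB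
  rw [Measure.map_apply measurable_snd hB, ← Set.univ_prod, hrect MeasurableSet.univ hB]
  simp

end JeffreysPosterior

section Chain

variable {Ω : Type*} [MeasurableSpace Ω] {P : Measure Ω}

theorem map_prodMk_add_eq_withDensity {E G : Type*} [MeasurableSpace E] [AddCommGroup G]
    [MeasurableSpace G] [MeasurableAdd₂ G] [MeasurableSub₂ G] {μ : Measure G} [SigmaFinite μ]
    [μ.IsAddLeftInvariant] [IsProbabilityMeasure P] {X : Ω → E} {W : Ω → G} (hX : Measurable X)
    (hW : Measurable W) (hind : IndepFun X W P) {g : G → ℝ≥0∞} (hg : Measurable g)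
    (hlaw : P.map W = μ.withDensity g) {T : E → G} (hT : Measurable T) :
    P.map (fun ω => (X ω, T (X ω) + W ω)) =
      ((P.map X).prod μ).withDensity (fun b => g (b.2 - T b.1)) := by
  have := Measure.isProbabilityMeasure_map (μ := P) hX.aemeasurable
  have hshear : MeasurePreserving (fun b : E × G => (b.1, T b.1 + b.2)) ((P.map X).prod μ)
      ((P.map X).prod μ) :=
    (MeasurePreserving.id _).skew_product (g := fun a w => T a + w) (by fun_prop)
      (ae_of_all _ fun a => map_add_left_eq_self μ (T a))
  have hcomp : (fun b : E × G => g b.2) =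
      (fun b => g (b.2 - T b.1)) ∘ fun b => (b.1, T b.1 + b.2) := by
    funext b
    simp
  calc P.map (fun ω => (X ω, T (X ω) + W ω))
    _ = (P.map fun ω => (X ω, W ω)).map fun b => (b.1, T b.1 + b.2) :=
      (Measure.map_map hshear.measurable (hX.prodMk hW)).symm
    _ = (((P.map X).prod μ).withDensity fun b => g b.2).map fun b => (b.1, T b.1 + b.2) := by
      rw [(indepFun_iff_map_prod_eq_prod_map_map hX.aemeasurable hW.aemeasurable).1 hind, hlaw,
        prod_withDensity_right hg]
    _ = _ := by
      rw [hcomp, map_withDensity_comp hshear.measurable (by fun_prop), hshear.map_eq]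

/-- Splitting off the last coordinate of a finite family, as a measurable equivalence. -/
def initLastEquiv {n : ℕ} (E : Fin (n + 1) → Type*) [∀ i, MeasurableSpace (E i)] :
    (∀ i, E i) ≃ᵐ (∀ i : Fin n, E i.castSucc) × E (Fin.last n) where
  toFun y := (Fin.init y, y (Fin.last n))
  invFun a := Fin.snoc a.1 a.2
  left_inv y := by simp
  right_inv a := by simp
  measurable_toFun := by
    change Measurable fun y : ∀ i, E i => ((fun i : Fin n => y i.castSucc), y (Fin.last n))
    fun_prop
  measurable_invFun := by
    refine measurable_pi_lambda _ fun i => ?_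
    induction i using Fin.lastCases with
    | last => simpa using measurable_snd
    | cast i => simpa using measurable_fst.eval

theorem measurePreserving_initLastEquiv {n : ℕ} {E : Fin (n + 1) → Type*}
    [∀ i, MeasurableSpace (E i)] (μ : ∀ i, Measure (E i)) [∀ i, SigmaFinite (μ i)] :
    MeasurePreserving (initLastEquiv E) (Measure.pi μ)
      ((Measure.pi fun i : Fin n => μ i.castSucc).prod (μ (Fin.last n))) := by
  refine MeasurePreserving.symm (initLastEquiv E).symm
    ⟨(initLastEquiv E).symm.measurable, (Measure.pi_eq fun B _ => ?_).symm⟩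
  have hpre : (initLastEquiv E).symm ⁻¹' Set.univ.pi B =
      (Set.univ.pi fun i : Fin n => B i.castSucc) ×ˢ B (Fin.last n) := by
    ext a
    simp [initLastEquiv, Set.mem_pi, Fin.forall_fin_succ']
  rw [MeasurableEquiv.map_apply, hpre, Measure.prod_prod, Measure.pi_pi, Fin.prod_univ_castSucc]

theorem map_eq_withDensity_of_init_of_last {n : ℕ} {E : Fin (n + 1) → Type*}
    [∀ i, MeasurableSpace (E i)] (μ : ∀ i, Measure (E i)) [∀ i, SigmaFinite (μ i)]
    {Y : Ω → ∀ i, E i} (hY : Measurable Y) {G : (∀ i : Fin n, E i.castSucc) → ℝ≥0∞}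
    (hG : Measurable G) {g : (∀ i : Fin n, E i.castSucc) × E (Fin.last n) → ℝ≥0∞}
    (hg : Measurable g)
    (hinit : P.map (fun ω => Fin.init (Y ω)) =
      (Measure.pi fun i : Fin n => μ i.castSucc).withDensity G)
    (hlast : P.map (fun ω => (Fin.init (Y ω), Y ω (Fin.last n))) =
      ((P.map fun ω => Fin.init (Y ω)).prod (μ (Fin.last n))).withDensity g) :
    P.map Y = (Measure.pi μ).withDensity fun y => G (Fin.init y) * g (initLastEquiv E y) := by
  have hsplit := measurePreserving_initLastEquiv μ
  apply (initLastEquiv E).map_measurableEquiv_injective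
  rw [Measure.map_map (initLastEquiv E).measurable hY]
  refine hlast.trans ?_
  rw [hinit, prod_withDensity_left hG, ← withDensity_mul _ (by fun_prop) hg, ← hsplit.map_eq,
    ← map_withDensity_comp hsplit.measurable (by fun_prop)]
  rfl

theorem map_pi_eq_withDensity_of_unique {ι : Type*} [Unique ι] {E : ι → Type*}
    [∀ t, MeasurableSpace (E t)] (μ : ∀ t, Measure (E t)) [∀ t, SigmaFinite (μ t)]
    {Y : ∀ t, Ω → E t} (hY : ∀ t, Measurable (Y t)) {g : E default → ℝ≥0∞} (hg : Measurable g)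
    (h : P.map (Y default) = (μ default).withDensity g) :
    P.map (fun ω t => Y t ω) = (Measure.pi μ).withDensity fun y => g (y default) := by
  have hunique := measurePreserving_piUnique μ
  apply (MeasurableEquiv.piUnique E).map_measurableEquiv_injective
  rw [Measure.map_map (MeasurableEquiv.measurable _) (by fun_prop)]
  refine h.trans ?_
  rw [← hunique.map_eq]
  exact (map_withDensity_comp hunique.measurable hg).symm

theorem map_chain_eq_withDensity [IsProbabilityMeasure P] {m : ℕ} {E : Fin (m + 1) → Type*}
    [∀ t, AddCommGroup (E t)] [∀ t, MeasurableSpace (E t)] [∀ t, MeasurableAdd₂ (E t)]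
    [∀ t, MeasurableSub₂ (E t)] (μ : ∀ t, Measure (E t)) [∀ t, SigmaFinite (μ t)]
    [∀ t, (μ t).IsAddLeftInvariant] {Y : ∀ t, Ω → E t} (hY : ∀ t, Measurable (Y t))
    {W : ∀ i : Fin m, Ω → E i.succ} (hW : ∀ i, Measurable (W i))
    {T : ∀ i : Fin m, E i.castSucc → E i.succ} (hT : ∀ i, Measurable (T i))
    (hYW : ∀ i ω, Y i.succ ω = T i (Y i.castSucc ω) + W i ω)
    (hind : ∀ i, IndepFun (W i) (fun ω (t : {t : Fin (m + 1) // t ≤ i.castSucc}) => Y t ω) P)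
    {g₀ : E 0 → ℝ≥0∞} (hg₀ : Measurable g₀) (h₀ : P.map (Y 0) = (μ 0).withDensity g₀)
    {g : ∀ i : Fin m, E i.succ → ℝ≥0∞} (hg : ∀ i, Measurable (g i))
    (hlaw : ∀ i, P.map (W i) = (μ i.succ).withDensity (g i)) :
    P.map (fun ω t => Y t ω) = (Measure.pi μ).withDensity
      (fun y => g₀ (y 0) * ∏ i : Fin m, g i (y i.succ - T i (y i.castSucc))) := by
  induction m with
  | zero =>
    simp only [Finset.univ_eq_empty, Finset.prod_empty, mul_one]
    exact map_pi_eq_withDensity_of_unique (ι := Fin 1) μ hY hg₀ h₀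
  | succ m ih =>
    have hind_past (i : Fin m) : IndepFun (W i.castSucc)
        (fun ω (t : {t : Fin (m + 1) // t ≤ i.castSucc}) => Y t.1.castSucc ω) P :=
      (hind i.castSucc).comp measurable_id
        (ψ := fun (w : ∀ t : {t // t ≤ i.castSucc.castSucc}, E t)
          (t : {t : Fin (m + 1) // t ≤ i.castSucc}) =>
            w ⟨t.1.castSucc, Fin.castSucc_le_castSucc_iff.2 t.2⟩) (by fun_prop)
    have hind_last : IndepFun (fun ω (t : Fin (m + 1)) => Y t.castSucc ω) (W (Fin.last m)) P :=
      ((hind (Fin.last m)).comp measurable_id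
        (ψ := fun (w : ∀ t : {t // t ≤ (Fin.last m).castSucc}, E t) (t : Fin (m + 1)) =>
          w ⟨t.castSucc, Fin.castSucc_le_castSucc_iff.2 (Fin.le_last t)⟩) (by fun_prop)).symm
    have hpast := ih (fun t => μ t.castSucc) (fun t => hY t.castSucc) (fun i => hW i.castSucc)
      (fun i => hT i.castSucc) (fun i => hYW i.castSucc) hind_past hg₀ h₀
      (fun i => hg i.castSucc) (fun i => hlaw i.castSucc)
    have hlast := map_prodMk_add_eq_withDensity (by fun_prop) (hW (Fin.last m)) hind_last
      (hg (Fin.last m)) (hlaw (Fin.last m)) (T := fun a => T (Fin.last m) (a (Fin.last m)))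
      ((hT (Fin.last m)).comp (measurable_pi_apply _))
    simp_rw [← hYW] at hlast
    refine (map_eq_withDensity_of_init_of_last μ (by fun_prop) ?_ ?_ hpast hlast).trans ?_
    · refine Measurable.fun_mul ?_ (Finset.measurable_fun_prod _ fun i _ => ?_)
      · exact hg₀.comp (measurable_pi_apply (0 : Fin (m + 1)))
      · exact (hg i.castSucc).comp <| (measurable_pi_apply i.succ).sub <|
          (hT i.castSucc).comp (measurable_pi_apply i.castSucc)
    · exact (hg (Fin.last m)).comp <| measurable_snd.sub <|
        (hT (Fin.last m)).comp <| (measurable_pi_apply _).comp measurable_fst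
    · congr with y
      rw [Fin.prod_univ_castSucc, ← mul_assoc]
      rfl

end Chain

section Likelihood

variable {ι κ : Type*} [Fintype ι] [DecidableEq ι] [Fintype κ] {H : Matrix ι κ ℝ}
  {R : Matrix ι ι ℝ} {a : EuclideanSpace ℝ κ × ℝ}

theorem krigingLik_pos (hR : R.PosDef) (ha : 0 < a.2) (y : EuclideanSpace ℝ ι) :
    0 < krigingLik H R y a :=
  Real.toNNReal_pos.2 (multivariateGaussianPDFReal_pos (hR.smul ha) _ y)

theorem continuous_krigingLik {X : Type*} [TopologicalSpace X] {H : X → Matrix ι κ ℝ}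
    {y : X → EuclideanSpace ℝ ι} (hH : Continuous H) (hy : Continuous y) (R : Matrix ι ι ℝ)
    (a : EuclideanSpace ℝ κ × ℝ) : Continuous fun w => krigingLik (H w) R (y w) a :=
  continuous_real_toNNReal.comp <| continuous_multivariateGaussianPDFReal (a.2 • R)
    ((PiLp.continuous_toLp 2 _).comp (hH.matrix_mulVec continuous_const)) hy

theorem measurable_coe_krigingLik_right (H : Matrix ι κ ℝ) (R : Matrix ι ι ℝ)
    (a : EuclideanSpace ℝ κ × ℝ) : Measurable fun y => (krigingLik H R y a : ℝ≥0∞) :=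
  (continuous_krigingLik continuous_const continuous_id R a).measurable.coe_nnreal_ennreal

theorem krigingLaw_eq_withDensity (hR : R.PosDef) (ha : 0 < a.2) :
    krigingLaw H R a = volume.withDensity fun y => (krigingLik H R y a : ℝ≥0∞) :=
  multivariateGaussian_eq_withDensity (hR.smul ha) _

theorem isPosterior_krigingLaw (hR : R.PosDef) {y : EuclideanSpace ℝ ι}
    {post : Measure (EuclideanSpace ℝ κ × ℝ)}
    (h : IsBayesUpdate (jeffreysPrior κ) (krigingLik H R y) post) :
    IsPosterior (jeffreysPrior κ) (krigingLaw H R) id y post :=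
  ⟨fun a y => krigingLik H R y a, (ae_pos_jeffreysPrior κ).mono fun a ha =>
    ⟨continuous_krigingLik continuous_const continuous_id R a, by
      rw [Measure.map_id, krigingLaw_eq_withDensity hR ha]⟩, h⟩

end Likelihood

section Observations

variable {d n n' a b : ℕ} {D : Set (EuclideanSpace ℝ (Fin d))} {Ω : Type*}

/-- The design matrix of a level with design points `x` nested by `e` in the design of the previous
level, where `w` are the observations of the previous level, and `g`, `h` are the regression
functions of the scale factor and of the trend. -/
def nestedDesign (g : D → Fin a → ℝ) (h : D → Fin b → ℝ) (x : Fin n → D) (e : Fin n → Fin n')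
    (w : EuclideanSpace ℝ (Fin n')) : Matrix (Fin n) (Fin a ⊕ Fin b) ℝ :=
  coDesign (regMatrix g x) (fun j => w (e j)) (regMatrix h x)

/-- The vector `c ⊙ w`, where `w` is restricted to the nested design by `e`. -/
def scaledRestrict (c : Fin n → ℝ) (e : Fin n → Fin n') (w : EuclideanSpace ℝ (Fin n')) :
    EuclideanSpace ℝ (Fin n) :=
  WithLp.toLp 2 fun j => c j * w (e j)

theorem measurable_scaledRestrict (c : Fin n → ℝ) (e : Fin n → Fin n') :
    Measurable (scaledRestrict c e) := by
  unfold scaledRestrict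
  fun_prop

theorem continuous_nestedDesign (g : D → Fin a → ℝ) (h : D → Fin b → ℝ) (x : Fin n → D)
    (e : Fin n → Fin n') : Continuous (nestedDesign g h x e) := by
  refine continuous_matrix fun j k => ?_
  cases k <;>
  · simp only [nestedDesign, coDesign, fromCols_apply_inl, fromCols_apply_inr, of_apply]
    fun_prop

theorem toLp_nestedDesign_mulVec (g : D → Fin a → ℝ) (h : D → Fin b → ℝ) (x : Fin n → D)
    (e : Fin n → Fin n') (w : EuclideanSpace ℝ (Fin n')) (c : Fin a ⊕ Fin b → ℝ) :
    WithLp.toLp 2 (nestedDesign g h x e w *ᵥ c) =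
      scaledRestrict (fun j => ∑ k, g (x j) k * c (Sum.inl k)) e w +
        WithLp.toLp 2 (regMatrix h x *ᵥ fun k => c (Sum.inr k)) := by
  ext j
  simp [nestedDesign, coDesign, scaledRestrict, regMatrix, mulVec, dotProduct, Finset.sum_mul,
    mul_right_comm]

theorem krigingLik_sub_scaledRestrict (g : D → Fin a → ℝ) (h : D → Fin b → ℝ) (x : Fin n → D)
    (e : Fin n → Fin n') (R : Matrix (Fin n) (Fin n) ℝ) (w : EuclideanSpace ℝ (Fin n'))
    (y : EuclideanSpace ℝ (Fin n)) (c : EuclideanSpace ℝ (Fin a ⊕ Fin b) × ℝ) :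
    krigingLik (regMatrix h x) R
        (y - scaledRestrict (fun j => ∑ k, g (x j) k * c.1 (Sum.inl k)) e w)
        (WithLp.toLp 2 fun k => c.1 (Sum.inr k), c.2) =
      krigingLik (nestedDesign g h x e w) R y c := by
  simp only [krigingLik, multivariateGaussianPDFReal, toLp_nestedDesign_mulVec, sub_sub]

variable [MeasurableSpace Ω]

theorem measurable_obs {Y : D → Ω → ℝ} (hY : ∀ u, Measurable (Y u)) (x : Fin n → D) :
    Measurable (obs Y x) :=
  (WithLp.measurable_toLp 2 _).comp (measurable_pi_lambda _ fun j => hY (x j))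

theorem map_obs_eq_krigingLaw {P : Measure Ω} {Y : D → Ω → ℝ} (hY : IsGaussianProcess Y P)
    {h : D → Fin b → ℝ} {ρ : EuclideanSpace ℝ (Fin d) → ℝ} {c : EuclideanSpace ℝ (Fin b) × ℝ}
    (hmean : ∀ u, ∫ ω, Y u ω ∂P = ∑ k, h u k * c.1 k)
    (hcov : ∀ u u' : D, covariance (Y u) (Y u') P = c.2 * ρ (u - u')) {x : Fin n → D}
    (hR : (corrMatrix ρ x).PosSemidef) (hc : 0 ≤ c.2) :
    P.map (obs Y x) = krigingLaw (regMatrix h x) (corrMatrix ρ x) c :=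
  map_toLp_eq_multivariateGaussian hY x (hR.smul hc) (fun j => hmean (x j))
    fun j k => hcov (x j) (x k)

end Observations

section Model

variable {m d : ℕ} {p : Fin (m + 1) → ℕ} {q : Fin m → ℕ} {D : Set (EuclideanSpace ℝ (Fin d))}
  {Ω : Type*} {f : (t : Fin (m + 1)) → D → Fin (p t) → ℝ}
  {fρ : (i : Fin m) → D → Fin (q i) → ℝ} {r : Fin (m + 1) → EuclideanSpace ℝ (Fin d) → ℝ}
  {Z : Fin (m + 1) → D → Ω → ℝ} {ψ : Params p q}

theorem PosVariances.replaceLevel (hψ : PosVariances ψ) (i : Fin m)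
    {c : EuclideanSpace ℝ (Fin (q i) ⊕ Fin (p i.succ)) × ℝ} (hc : 0 < c.2) :
    PosVariances (replaceLevel ψ i c) := by
  refine ⟨hψ.1, fun k => ?_⟩
  by_cases hk : k = i
  · subst hk
    simpa [CoKriging.replaceLevel] using hc
  · simpa [CoKriging.replaceLevel, hk] using hψ.2 k

theorem ae_posVariances (p : Fin (m + 1) → ℕ) (q : Fin m → ℕ) :
    ∀ᵐ ψ ∂paramPrior p q, PosVariances ψ := by
  have hsucc (i : Fin m) := (Measure.quasiMeasurePreserving_eval
    (fun i : Fin m => jeffreysPrior (Fin (q i) ⊕ Fin (p i.succ))) i).ae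
    (p := fun a => 0 < a.2) (ae_pos_jeffreysPrior _)
  exact (Measure.quasiMeasurePreserving_fst.ae (ae_pos_jeffreysPrior _)).and
    (Measure.quasiMeasurePreserving_snd.ae (ae_all_iff.2 hsucc))

theorem obs_succ (fρ : (i : Fin m) → D → Fin (q i) → ℝ) (Z : Fin (m + 1) → D → Ω → ℝ)
    (ψ : Params p q) (i : Fin m) {n n' : ℕ} {x : Fin n → D} {x' : Fin n' → D}
    {e : Fin n → Fin n'} (he : ∀ j, x j = x' (e j)) (ω : Ω) :
    obs (Z i.succ) x ω =
      scaledRestrict (fun j => scale fρ ψ i (x j)) e (obs (Z i.castSucc) x' ω) +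
        obs (discrepancy fρ Z ψ i) x ω := by
  ext j
  simp [obs, scaledRestrict, discrepancy, he]

variable [MeasurableSpace Ω] {P : Measure Ω}

theorem IsARModel.measurable_discrepancy (h : IsARModel f fρ r Z ψ P) (i : Fin m) (u : D) :
    Measurable (discrepancy fρ Z ψ i u) :=
  (h.measurable i.succ u).sub ((h.measurable i.castSucc u).const_mul _)

theorem IsARModel.indepFun_obs_discrepancy (h : IsARModel f fρ r Z ψ P) (i : Fin m) {n : ℕ}
    (x : Fin n → D) {n' : Fin (m + 1) → ℕ} (x' : ∀ t, Fin (n' t) → D) :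
    IndepFun (obs (discrepancy fρ Z ψ i) x)
      (fun ω (t : {t : Fin (m + 1) // t ≤ i.castSucc}) => obs (Z t) (x' t) ω) P := by
  refine (h.disc_indep i).comp (φ := fun w => WithLp.toLp 2 fun j => w (x j))
    (ψ := fun w (t : {t : Fin (m + 1) // t ≤ i.castSucc}) =>
      (WithLp.toLp 2 fun j => w (t, x' t j) : EuclideanSpace ℝ (Fin (n' t)))) ?_ ?_ <;>
  fun_prop

theorem IsARModel.map_obs_zero (h : IsARModel f fρ r Z ψ P) {n : ℕ} {x : Fin n → D}
    (hR : (corrMatrix (r 0) x).PosDef) (hv : 0 < ψ.1.2) :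
    P.map (obs (Z 0) x) = volume.withDensity fun y =>
      (krigingLik (regMatrix (f 0) x) (corrMatrix (r 0) x) y ψ.1 : ℝ≥0∞) :=
  (map_obs_eq_krigingLaw h.first_gaussian h.first_mean h.first_cov hR.posSemidef hv.le).trans
    (krigingLaw_eq_withDensity hR hv)

theorem IsARModel.map_obs_discrepancy (h : IsARModel f fρ r Z ψ P) (i : Fin m) {n : ℕ}
    {x : Fin n → D} (hR : (corrMatrix (r i.succ) x).PosDef) (hv : 0 < (ψ.2 i).2) :
    P.map (obs (discrepancy fρ Z ψ i) x) = volume.withDensity fun y =>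
      (krigingLik (regMatrix (f i.succ) x) (corrMatrix (r i.succ) x) y
        (WithLp.toLp 2 fun k => (ψ.2 i).1 (Sum.inr k), (ψ.2 i).2) : ℝ≥0∞) :=
  (map_obs_eq_krigingLaw (h.disc_gaussian i) (h.disc_mean i) (h.disc_cov i) hR.posSemidef
    hv.le).trans (krigingLaw_eq_withDensity hR hv)

theorem IsARModel.map_obs_castSucc_succ (h : IsARModel f fρ r Z ψ P) (i : Fin m) {n n' : ℕ}
    {x : Fin n → D} {x' : Fin n' → D} {e : Fin n → Fin n'} (he : ∀ j, x j = x' (e j))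
    (hR : (corrMatrix (r i.succ) x).PosDef) (hv : 0 < (ψ.2 i).2) :
    P.map (fun ω => (obs (Z i.castSucc) x' ω, obs (Z i.succ) x ω)) =
      ((P.map (obs (Z i.castSucc) x')).prod volume).withDensity fun b =>
        (krigingLik (nestedDesign (fρ i) (f i.succ) x e b.1) (corrMatrix (r i.succ) x) b.2
          (ψ.2 i) : ℝ≥0∞) := by
  have := h.isProbabilityMeasure
  have hind : IndepFun (obs (Z i.castSucc) x') (obs (discrepancy fρ Z ψ i) x) P :=
    ((h.indepFun_obs_discrepancy i x fun _ => x').comp measurable_id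
      (measurable_pi_apply (⟨i.castSucc, le_rfl⟩ : {t // t ≤ i.castSucc}))).symm
  have hlaw := map_prodMk_add_eq_withDensity (measurable_obs (h.measurable i.castSucc) x')
    (measurable_obs (h.measurable_discrepancy i) x) hind
    (measurable_coe_krigingLik_right _ _ _) (h.map_obs_discrepancy i hR hv)
    (measurable_scaledRestrict (fun j => scale fρ ψ i (x j)) e)
  simp_rw [← obs_succ fρ Z ψ i he] at hlaw
  simpa only [scale, krigingLik_sub_scaledRestrict] using hlaw

variable {n : Fin (m + 1) → ℕ} {x : (t : Fin (m + 1)) → Fin (n t) → D}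
  {e : (i : Fin m) → Fin (n i.succ) → Fin (n i.castSucc)}

/-- The likelihood of the parameters `ψ` when the values of the processes at the nested designs `x`
are `y`, as a product over the levels of one-level kriging likelihoods. -/
def jointLik (f : (t : Fin (m + 1)) → D → Fin (p t) → ℝ) (fρ : (i : Fin m) → D → Fin (q i) → ℝ)
    (r : Fin (m + 1) → EuclideanSpace ℝ (Fin d) → ℝ) (x : (t : Fin (m + 1)) → Fin (n t) → D)
    (e : (i : Fin m) → Fin (n i.succ) → Fin (n i.castSucc)) (ψ : Params p q)
    (y : (t : Fin (m + 1)) → EuclideanSpace ℝ (Fin (n t))) : ℝ≥0 :=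
  krigingLik (regMatrix (f 0) (x 0)) (corrMatrix (r 0) (x 0)) (y 0) ψ.1 *
    ∏ i : Fin m, krigingLik (nestedDesign (fρ i) (f i.succ) (x i.succ) (e i) (y i.castSucc))
      (corrMatrix (r i.succ) (x i.succ)) (y i.succ) (ψ.2 i)

theorem jointLik_pos (hR : ∀ t, (corrMatrix (r t) (x t)).PosDef) (hψ : PosVariances ψ)
    (y : (t : Fin (m + 1)) → EuclideanSpace ℝ (Fin (n t))) : 0 < jointLik f fρ r x e ψ y :=
  mul_pos (krigingLik_pos (hR 0) hψ.1 _)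
    (Finset.prod_pos fun i _ => krigingLik_pos (hR i.succ) (hψ.2 i) _)

theorem continuous_jointLik : Continuous (jointLik f fρ r x e ψ) := by
  refine Continuous.mul ?_ (continuous_finsetProd _ fun i _ => ?_)
  · exact continuous_krigingLik continuous_const (continuous_apply (0 : Fin (m + 1))) _ _
  · exact continuous_krigingLik
      ((continuous_nestedDesign _ _ _ _).comp (continuous_apply i.castSucc))
      (continuous_apply i.succ) _ _

theorem IsARModel.map_obs (h : IsARModel f fρ r Z ψ P) (hψ : PosVariances ψ)
    (he : ∀ i j, x i.succ j = x i.castSucc (e i j))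
    (hR : ∀ t, (corrMatrix (r t) (x t)).PosDef) :
    P.map (fun ω t => obs (Z t) (x t) ω) =
      volume.withDensity fun y => (jointLik f fρ r x e ψ y : ℝ≥0∞) := by
  have := h.isProbabilityMeasure
  have hlaw := map_chain_eq_withDensity (E := fun t => EuclideanSpace ℝ (Fin (n t)))
    (fun t => volume) (fun t => measurable_obs (h.measurable t) (x t))
    (fun i => measurable_obs (h.measurable_discrepancy i) (x i.succ))
    (fun i => measurable_scaledRestrict (fun j => scale fρ ψ i (x i.succ j)) (e i))
    (fun i ω => obs_succ fρ Z ψ i (he i) ω)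
    (fun i => h.indepFun_obs_discrepancy i (x i.succ) x)
    (measurable_coe_krigingLik_right _ _ _) (h.map_obs_zero (hR 0) hψ.1)
    (fun i => measurable_coe_krigingLik_right _ _ _)
    (fun i => h.map_obs_discrepancy i (hR i.succ) (hψ.2 i))
  simpa only [scale, krigingLik_sub_scaledRestrict, jointLik, ENNReal.coe_mul,
    ENNReal.ofNNReal_finsetProd, volume_pi] using hlaw

theorem IsARModel.isOpenPosMeasure_map_obs (h : IsARModel f fρ r Z ψ P) (hψ : PosVariances ψ)
    (he : ∀ i j, x i.succ j = x i.castSucc (e i j))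
    (hR : ∀ t, (corrMatrix (r t) (x t)).PosDef) (t : Fin (m + 1)) :
    (P.map (obs (Z t) (x t))).IsOpenPosMeasure := by
  have hobs : Measurable fun ω t => obs (Z t) (x t) ω :=
    measurable_pi_lambda _ fun t => measurable_obs (h.measurable t) (x t)
  have hjoint : (P.map fun ω t => obs (Z t) (x t) ω).IsOpenPosMeasure := by
    rw [h.map_obs hψ he hR]
    refine (withDensity_absolutelyContinuous' (μ := volume)
      continuous_jointLik.measurable.coe_nnreal_ennreal.aemeasurable
      (ae_of_all _ fun y => ?_)).isOpenPosMeasure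
    exact ENNReal.coe_ne_zero.2 (jointLik_pos hR hψ y).ne'
  have hmarginal := (continuous_apply t).isOpenPosMeasure_map
    (μ := P.map fun ω t => obs (Z t) (x t) ω) (Function.surjective_eval t)
  rwa [Measure.map_map (measurable_pi_apply t) hobs] at hmarginal

end Model

section Posterior

variable {m d : ℕ} {p : Fin (m + 1) → ℕ} {q : Fin m → ℕ} {D : Set (EuclideanSpace ℝ (Fin d))}
  {Ω : Type*} [MeasurableSpace Ω] {f : (t : Fin (m + 1)) → D → Fin (p t) → ℝ}
  {fρ : (i : Fin m) → D → Fin (q i) → ℝ} {r : Fin (m + 1) → EuclideanSpace ℝ (Fin d) → ℝ}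
  {Z : Fin (m + 1) → D → Ω → ℝ} {P : Params p q → Measure Ω} {ψ : Params p q}

theorem isPosterior_obs_zero {Par : Type*} [MeasurableSpace Par] {prior post : Measure Par}
    {n : ℕ} {x : Fin n → D} {z : EuclideanSpace ℝ (Fin n)}
    {c : Par → EuclideanSpace ℝ (Fin (p 0)) × ℝ}
    (hP : ∀ ψ, PosVariances ψ → IsARModel f fρ r Z ψ (P ψ))
    (hR : (corrMatrix (r 0) x).PosDef) (hψ : PosVariances ψ) (hc : ∀ᵐ a ∂prior, 0 < (c a).2)
    (h : IsBayesUpdate prior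
      (fun a => krigingLik (regMatrix (f 0) x) (corrMatrix (r 0) x) z (c a)) post) :
    IsPosterior prior (fun a => P (c a, ψ.2)) (obs (Z 0) x) z post :=
  ⟨fun a y => krigingLik (regMatrix (f 0) x) (corrMatrix (r 0) x) y (c a),
    hc.mono fun a ha => ⟨continuous_krigingLik continuous_const continuous_id _ _,
      (hP (c a, ψ.2) ⟨ha, hψ.2⟩).map_obs_zero hR ha⟩, h⟩

variable {n : Fin (m + 1) → ℕ} {x : (t : Fin (m + 1)) → Fin (n t) → D}
  {e : (i : Fin m) → Fin (n i.succ) → Fin (n i.castSucc)}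
  {z : (t : Fin (m + 1)) → EuclideanSpace ℝ (Fin (n t))}

theorem isCondPosterior_obs_succ {Par : Type*} [MeasurableSpace Par] {prior post : Measure Par}
    {i : Fin m} {c : Par → EuclideanSpace ℝ (Fin (q i) ⊕ Fin (p i.succ)) × ℝ}
    (he : ∀ i j, x i.succ j = x i.castSucc (e i j))
    (hP : ∀ ψ, PosVariances ψ → IsARModel f fρ r Z ψ (P ψ))
    (hR : ∀ t, (corrMatrix (r t) (x t)).PosDef) (hψ : PosVariances ψ)
    (hc : ∀ᵐ a ∂prior, 0 < (c a).2)
    (h : IsBayesUpdate prior (fun a => krigingLik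
      (nestedDesign (fρ i) (f i.succ) (x i.succ) (e i) (z i.castSucc))
      (corrMatrix (r i.succ) (x i.succ)) (z i.succ) (c a)) post) :
    IsCondPosterior prior (fun a => P (replaceLevel ψ i (c a)))
      (obs (Z i.castSucc) (x i.castSucc)) (z i.castSucc) (obs (Z i.succ) (x i.succ)) (z i.succ)
      post := by
  refine ⟨fun a b => krigingLik (nestedDesign (fρ i) (f i.succ) (x i.succ) (e i) b.1)
    (corrMatrix (r i.succ) (x i.succ)) b.2 (c a), hc.mono fun a ha => ?_, h⟩
  have hpos := hψ.replaceLevel i ha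
  have hlaw := (hP _ hpos).map_obs_castSucc_succ i (he i) (hR i.succ) (hpos.2 i)
  simp only [replaceLevel, Function.update_self] at hlaw
  exact ⟨(hP _ hpos).isOpenPosMeasure_map_obs hpos he hR _, continuous_krigingLik
    ((continuous_nestedDesign _ _ _ _).comp continuous_fst) continuous_snd _ _, hlaw⟩

theorem isPosterior_obs (he : ∀ i j, x i.succ j = x i.castSucc (e i j))
    (hP : ∀ ψ, PosVariances ψ → IsARModel f fρ r Z ψ (P ψ))
    (hR : ∀ t, (corrMatrix (r t) (x t)).PosDef)
    {post₀ : Measure (EuclideanSpace ℝ (Fin (p 0)) × ℝ)}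
    {post : (i : Fin m) → Measure (EuclideanSpace ℝ (Fin (q i) ⊕ Fin (p i.succ)) × ℝ)}
    (h₀ : IsBayesUpdate (jeffreysPrior (Fin (p 0)))
      (krigingLik (regMatrix (f 0) (x 0)) (corrMatrix (r 0) (x 0)) (z 0)) post₀)
    (h : ∀ i, IsBayesUpdate (jeffreysPrior (Fin (q i) ⊕ Fin (p i.succ)))
      (krigingLik (nestedDesign (fρ i) (f i.succ) (x i.succ) (e i) (z i.castSucc))
        (corrMatrix (r i.succ) (x i.succ)) (z i.succ)) (post i)) :
    IsPosterior (paramPrior p q) P (fun ω t => obs (Z t) (x t) ω) z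
      (post₀.prod (Measure.pi post)) :=
  ⟨jointLik f fρ r x e, (ae_posVariances p q).mono fun ψ hψ =>
      ⟨continuous_jointLik, (hP ψ hψ).map_obs hψ he hR⟩,
    h₀.prod (measurable_krigingLik _ _ _)
      (Finset.measurable_fun_prod _ fun i _ =>
        (measurable_krigingLik _ _ _).comp (measurable_pi_apply i))
      (IsBayesUpdate.pi (fun _ => measurable_krigingLik _ _ _) h)⟩

end Posterior

end CoKriging

end

theorem mainTheorem4 {m d : ℕ} (n p : Fin (m + 1) → ℕ) (q : Fin m → ℕ)
    -- input space and nested design sets, `x t` listing the points of `D_t`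
    (D : Set (EuclideanSpace ℝ (Fin d))) (x : (t : Fin (m + 1)) → Fin (n t) → D)
    (e : (i : Fin m) → Fin (n i.succ) → Fin (n i.castSucc))
    (he : ∀ i j, x i.succ j = x i.castSucc (e i j))
    -- regression functions, correlation functions and their hyper-parameters
    (f : (t : Fin (m + 1)) → D → Fin (p t) → ℝ) (fρ : (i : Fin m) → D → Fin (q i) → ℝ)
    {Θ : Fin (m + 1) → Type*} (θ : (t : Fin (m + 1)) → Θ t)
    (r : (t : Fin (m + 1)) → EuclideanSpace ℝ (Fin d) → Θ t → ℝ)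
    (R : (t : Fin (m + 1)) → Matrix (Fin (n t)) (Fin (n t)) ℝ)
    (hR : ∀ t, R t = CoKriging.corrMatrix (fun h => r t h (θ t)) (x t))
    (hRpos : ∀ t, (R t).PosDef)
    -- the processes, and their law `P ψ` given the parameters `ψ`
    {Ω : Type*} [MeasurableSpace Ω] (Z : Fin (m + 1) → D → Ω → ℝ)
    (P : CoKriging.Params p q → Measure Ω)
    (hP : ∀ ψ, CoKriging.PosVariances ψ →
      CoKriging.IsARModel f fρ (fun t h => r t h (θ t)) Z ψ (P ψ))
    -- the observations and the resulting design matrices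
    (z : (t : Fin (m + 1)) → EuclideanSpace ℝ (Fin (n t)))
    (F : Matrix (Fin (n 0)) (Fin (p 0)) ℝ) (hF : F = CoKriging.regMatrix (f 0) (x 0))
    (H : (i : Fin m) → Matrix (Fin (n i.succ)) (Fin (q i) ⊕ Fin (p i.succ)) ℝ)
    (hH : ∀ i, H i = CoKriging.coDesign (CoKriging.regMatrix (fρ i) (x i.succ))
      (fun j => z i.castSucc (e i j)) (CoKriging.regMatrix (f i.succ) (x i.succ))) :
    -- posterior of the coefficients of a level `t ≥ 2` given `z_t`, `z_{t-1}` and the variance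
    (∀ i, LinearIndependent ℝ (H i).col → ∀ ψ, CoKriging.PosVariances ψ → ∀ v : ℝ, 0 < v →
      CoKriging.IsCondPosterior volume (fun b => P (CoKriging.replaceLevel ψ i (b, v)))
        (CoKriging.obs (Z i.castSucc) (x i.castSucc)) (z i.castSucc)
        (CoKriging.obs (Z i.succ) (x i.succ)) (z i.succ)
        (multivariateGaussian (CoKriging.coefMean (H i) (R i.succ) (z i.succ))
          (v • CoKriging.coefCov (H i) (R i.succ)))) ∧
    -- joint posterior of coefficients and variance of a level `t ≥ 2` given `z_t`, `z_{t-1}`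
    (∀ i, LinearIndependent ℝ (H i).col →
      (¬ ∃ b : Fin (q i) ⊕ Fin (p i.succ) → ℝ, (z i.succ).ofLp = H i *ᵥ b) →
      ∃ post : Measure (EuclideanSpace ℝ (Fin (q i) ⊕ Fin (p i.succ)) × ℝ),
        (∀ ψ, CoKriging.PosVariances ψ →
          CoKriging.IsCondPosterior (CoKriging.jeffreysPrior (Fin (q i) ⊕ Fin (p i.succ)))
            (fun a => P (CoKriging.replaceLevel ψ i a))
            (CoKriging.obs (Z i.castSucc) (x i.castSucc)) (z i.castSucc)
            (CoKriging.obs (Z i.succ) (x i.succ)) (z i.succ) post) ∧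
        CoKriging.IsGaussianInvGamma (H i) (R i.succ) (z i.succ)
          (((n i.succ : ℝ) - (p i.succ : ℝ) - (q i : ℝ)) / 2) post) ∧
    -- the same for the first level
    (LinearIndependent ℝ F.col → ∀ ψ, CoKriging.PosVariances ψ → ∀ v : ℝ, 0 < v →
      CoKriging.IsPosterior volume (fun b => P ((b, v), ψ.2))
        (CoKriging.obs (Z 0) (x 0)) (z 0)
        (multivariateGaussian (CoKriging.coefMean F (R 0) (z 0))
          (v • CoKriging.coefCov F (R 0)))) ∧
    (LinearIndependent ℝ F.col → (¬ ∃ b : Fin (p 0) → ℝ, (z 0).ofLp = F *ᵥ b) →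
      ∃ post : Measure (EuclideanSpace ℝ (Fin (p 0)) × ℝ),
        (∀ ψ, CoKriging.PosVariances ψ →
          CoKriging.IsPosterior (CoKriging.jeffreysPrior (Fin (p 0))) (fun a => P (a, ψ.2))
            (CoKriging.obs (Z 0) (x 0)) (z 0) post) ∧
        CoKriging.IsGaussianInvGamma F (R 0) (z 0) (((n 0 : ℝ) - (p 0 : ℝ)) / 2) post) ∧
    -- the posterior of all parameters given all observations is the product of the posteriors
    -- of independent one-level krigings with design matrices `F` and `H i`
    (LinearIndependent ℝ F.col → (¬ ∃ b : Fin (p 0) → ℝ, (z 0).ofLp = F *ᵥ b) →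
      (∀ i, LinearIndependent ℝ (H i).col) →
      (∀ i, ¬ ∃ b : Fin (q i) ⊕ Fin (p i.succ) → ℝ, (z i.succ).ofLp = H i *ᵥ b) →
      ∃ (post₀ : Measure (EuclideanSpace ℝ (Fin (p 0)) × ℝ))
        (post : (i : Fin m) → Measure (EuclideanSpace ℝ (Fin (q i) ⊕ Fin (p i.succ)) × ℝ)),
        CoKriging.IsPosterior (CoKriging.jeffreysPrior (Fin (p 0)))
          (CoKriging.krigingLaw F (R 0)) id (z 0) post₀ ∧
        CoKriging.IsGaussianInvGamma F (R 0) (z 0) (((n 0 : ℝ) - (p 0 : ℝ)) / 2) post₀ ∧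
        (∀ i, CoKriging.IsPosterior (CoKriging.jeffreysPrior (Fin (q i) ⊕ Fin (p i.succ)))
            (CoKriging.krigingLaw (H i) (R i.succ)) id (z i.succ) (post i) ∧
          CoKriging.IsGaussianInvGamma (H i) (R i.succ) (z i.succ)
            (((n i.succ : ℝ) - (p i.succ : ℝ) - (q i : ℝ)) / 2) (post i)) ∧
        CoKriging.IsPosterior (CoKriging.paramPrior p q) P
          (fun ω (t : Fin (m + 1)) => CoKriging.obs (Z t) (x t) ω) z
          (post₀.prod (Measure.pi post))) := by
  obtain ⟨rfl, rfl, rfl⟩ := And.intro hF (And.intro (funext hR) (funext hH))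
  have hα₀ : ((n 0 : ℝ) - p 0) / 2 = (Fintype.card (Fin (n 0)) - Fintype.card (Fin (p 0))) / 2 := by
    simp only [Fintype.card_fin]
  have hα (i : Fin m) : ((n i.succ : ℝ) - p i.succ - q i) / 2 =
      (Fintype.card (Fin (n i.succ)) - Fintype.card (Fin (q i) ⊕ Fin (p i.succ))) / 2 := by
    simp only [Fintype.card_fin, Fintype.card_sum, Nat.cast_add, sub_add_eq_sub_sub_swap]
  refine ⟨fun i hi ψ hψ v hv => ?_, fun i hi hz => ⟨_, fun ψ hψ => ?_,
      CoKriging.isGaussianInvGamma_jeffreysPosterior (hRpos i.succ) hi hz (hα i)⟩,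
    fun h₀ ψ hψ v hv => ?_, fun h₀ hz₀ => ⟨_, fun ψ hψ => ?_,
      CoKriging.isGaussianInvGamma_jeffreysPosterior (hRpos 0) h₀ hz₀ hα₀⟩,
    fun h₀ hz₀ hi hz => ?_⟩
  · exact CoKriging.isCondPosterior_obs_succ (c := fun b => (b, v)) he hP hRpos hψ
      (ae_of_all _ fun _ => hv) (CoKriging.isBayesUpdate_krigingLik (hRpos i.succ) hi _ hv)
  · exact CoKriging.isCondPosterior_obs_succ he hP hRpos hψ (CoKriging.ae_pos_jeffreysPrior _)
      (CoKriging.isBayesUpdate_jeffreysPosterior (hRpos i.succ) hi hz)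
  · exact CoKriging.isPosterior_obs_zero (c := fun b => (b, v)) hP (hRpos 0) hψ
      (ae_of_all _ fun _ => hv) (CoKriging.isBayesUpdate_krigingLik (hRpos 0) h₀ _ hv)
  · exact CoKriging.isPosterior_obs_zero hP (hRpos 0) hψ (CoKriging.ae_pos_jeffreysPrior _)
      (CoKriging.isBayesUpdate_jeffreysPosterior (hRpos 0) h₀ hz₀)
  · have post₀ := CoKriging.isBayesUpdate_jeffreysPosterior (hRpos 0) h₀ hz₀
    have post (i : Fin m) := CoKriging.isBayesUpdate_jeffreysPosterior (hRpos i.succ) (hi i) (hz i)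
    exact ⟨_, _, CoKriging.isPosterior_krigingLaw (hRpos 0) post₀,
      CoKriging.isGaussianInvGamma_jeffreysPosterior (hRpos 0) h₀ hz₀ hα₀,
      fun i => ⟨CoKriging.isPosterior_krigingLaw (hRpos i.succ) (post i),
        CoKriging.isGaussianInvGamma_jeffreysPosterior (hRpos i.succ) (hi i) (hz i) (hα i)⟩,
      CoKriging.isPosterior_obs he hP hRpos post₀ post⟩
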